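/- A \emph{weight} on $\mathbb{R}$ is a locally integrable function $w:\mathbb{R}\to\mathbb{R}$ with $w>0$ almost everywhere; write $w(E)=\int_E w(x)\,dx$, and let $|E|$ denote Lebesgue measure. Intervals $I$ are compact and of positive length, and $2I$ is the interval with the same centre as $I$ and twice its length. A weight $w$ is \begin{itemize} \item \emph{doubling} if the measure $w(x)\,dx$ is not zero and there is $K>0$ with $w(2I)\le K\,w(I)$ for all intervals $I$; \item a \emph{$C_p$ weight}, $1<p<\infty$, if $\int_{\mathbb{R}}(M\mathbf 1_I)^p\,w\,dx<\infty$ for every interval $I$ and there are $C,\varepsilon>0$ such that $$\frac{w(E)}{\int_{\mathbb{R}}(M\mathbf 1_I)^p\,w\,dx}\le C\left(\frac{|E|}{|I|}\right)^{\varepsilon}$$ for all intervals $I$ and all compact $E\subset I$, where $Mf(x)=\sup_{r>0}\frac1{2r}\int_{x-r}^{x+r}|f(y)|\,dy$ is the Hardy--Littlewood maximal function; \item an \emph{$A_\infty$ weight} if it belongs to $A_\infty=\bigcup_{1<q<\infty}A_q$, where $w\in A_q$ means that $$\sup_I\left(\frac1{|I|}\int_I w\,dx\right)\left(\frac1{|I|}\int_I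 w^{\frac1{1-q}}\,dx\right)^{q-1}<\infty .$$ \end{itemize} \textbf{Theorem.} For every $p$ with $1<p<\infty$ there exists a weight $w$ on $\mathbb{R}$ that is doubling and satisfies the $C_p$ condition but is not an $A_\infty$ weight: $w$ is in no $A_q$ with $1<q<\infty$, and also fails the usual equivalent form of $A_\infty$, that is, there are no $C,\varepsilon>0$ such that $\frac{w(E)}{w(I)}\le C\left(\frac{|E|}{|I|}\right)^{\varepsilon}$ for all intervals $I$ and all measurable $E\subset I$. -/

import Mathlib

open MeasureTheory Set Metric
open scoped ENNReal NNReal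

noncomputable section

/-- A weight on the real line: a locally integrable function that is positive almost everywhere. -/
structure IsWeight (w : ℝ → ℝ) : Prop where
  locallyIntegrable : LocallyIntegrable w volume
  ae_pos : ∀ᵐ x ∂(volume : Measure ℝ), 0 < w x

/-- The measure `w(x) dx`, so that `weightMeasure w E` is `w(E) = |E|_w`. -/
def weightMeasure (w : ℝ → ℝ) : Measure ℝ :=
  volume.withDensity (fun x => ENNReal.ofReal (w x))

/-- Doubling measures on the real line. The cubes of `ℝ` are the compact intervals
`I = [c - r, c + r] = closedBall c r` with `r > 0`, and `2 I = closedBall c (2 * r)`. -/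
def IsDoubling (μ : Measure ℝ) : Prop :=
  μ ≠ 0 ∧ ∃ K : ℝ≥0, 0 < K ∧ ∀ c r : ℝ, 0 < r →
    μ (closedBall c (2 * r)) ≤ K * μ (closedBall c r)

/-- The (centred) Hardy-Littlewood maximal function
`M f (x) = sup_{r > 0} (1 / 2r) ∫_{x - r}^{x + r} |f(y)| dy`. -/
def maximalFn (f : ℝ → ℝ) (x : ℝ) : ℝ≥0∞ :=
  ⨆ (r : ℝ) (_ : 0 < r), ⨍⁻ y in closedBall x r, ‖f y‖ₑ ∂volume

/-- The quantity `∫ (M 1_I)^p w dx`. -/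
def maximalIntegral (p : ℝ) (w : ℝ → ℝ) (I : Set ℝ) : ℝ≥0∞ :=
  ∫⁻ x, (maximalFn (I.indicator fun _ => 1) x) ^ p ∂(weightMeasure w)

/-- The `C_p` condition: `∫ (M 1_I)^p w < ∞` for all intervals `I`, and there are `C, ε > 0` with
`w(E) / ∫ (M 1_I)^p w ≤ C (|E| / |I|)^ε` for all intervals `I` and all compact `E ⊆ I`. -/
def IsCp (p : ℝ) (w : ℝ → ℝ) : Prop :=
  (∀ c r : ℝ, 0 < r → maximalIntegral p w (closedBall c r) < ∞) ∧
  ∃ (C : ℝ≥0) (ε : ℝ), 0 < C ∧ 0 < ε ∧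
    ∀ c r : ℝ, 0 < r → ∀ E : Set ℝ, IsCompact E → E ⊆ closedBall c r →
      weightMeasure w E / maximalIntegral p w (closedBall c r)
        ≤ C * (volume E / volume (closedBall c r)) ^ ε

/-- The Muckenhoupt `A_q` condition (for `1 < q < ∞`). -/
def IsAq (q : ℝ) (w : ℝ → ℝ) : Prop :=
  ∃ C : ℝ≥0, ∀ c r : ℝ, 0 < r →
    (⨍⁻ x in closedBall c r, ENNReal.ofReal (w x) ∂volume) *
      (⨍⁻ x in closedBall c r, ENNReal.ofReal (w x) ^ (1 / (1 - q)) ∂volume) ^ (q - 1) ≤ C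

/-- The class `A_∞`, as the union of the classes `A_q`, `1 < q < ∞`. -/
def IsAInfty (w : ℝ → ℝ) : Prop :=
  ∃ q : ℝ, 1 < q ∧ IsAq q w

/-- The other usual form of `A_∞`: there are `C, ε > 0` with `w(E) / w(I) ≤ C (|E| / |I|)^ε` for all
intervals `I` and all measurable `E ⊆ I`. -/
def IsAInftyPower (w : ℝ → ℝ) : Prop :=
  ∃ (C : ℝ≥0) (ε : ℝ), 0 < C ∧ 0 < ε ∧
    ∀ c r : ℝ, 0 < r → ∀ E : Set ℝ, MeasurableSet E → E ⊆ closedBall c r →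
      weightMeasure w E / weightMeasure w (closedBall c r)
        ≤ C * (volume E / volume (closedBall c r)) ^ ε

end

/-! The weight is a multiplicative cascade that oscillates, near a point `x` close to the origin,
only at scales between `|x|` and `x ^ 2`. Digit factors `f 0 = f 2` and `f 1` of mean one are fixed,
with `f 0` very small. At a point with `|x|` about `3⁻ʲ` the weight is the product of the factors
over the first `2 * j` ternary digits of `|x|`; away from the origin it is one.

Doubling: since `f 0 = f 2`, a carry does not spoil the comparison of neighbouring cylinders
(`IsBalanced.cascade_adjacent`), and neighbours are stopped at nearly the same generation
(`IsBalanced.triadicMass_adjacent`).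

Failure of `A_∞`: on `[3⁻ʲ, 2 * 3⁻ʲ)` the weight is a constant times `j` further generations of a
nonconstant cascade. Its negative powers have normalised means growing geometrically in `j`, and its
mass concentrates on a set of geometrically small proportion (`exists_concentration`).

The `C_p` condition: on an interval with centre `c` and radius `r`, where `16 * r ≤ c ^ 2`, the
weight is constant up to bounded factors. If `r` is larger, but bounded, the oscillation is visible,
yet the first `j - 1` digits are zero and make the weight at most a constant times `|x| ^ k`, hence
`r ^ (k / 2)`. With `k ≥ 2 * (p - 1)` its supremum times `|I|` is at most a constant times `r ^ p`,
which the tail of `(M 1_I) ^ p` over `[5, 6]` already dominates (`IsBalanced.isCp`). -/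

/-! ### Ternary cascades -/

/-- The product of the factors `f d` over the last `n` ternary digits `d` of `i`. -/
def cascade (f : ℕ → ℝ≥0) : ℕ → ℕ → ℝ≥0
  | 0, _ => 1
  | n + 1, i => cascade f n (i / 3) * f (i % 3)

/-- Digit factors which agree on the two extreme digits, have mean one, and are at least `K⁻¹`. -/
structure IsBalanced (f : ℕ → ℝ≥0) (K : ℝ≥0) : Prop where
  three_le : 3 ≤ K
  symm : f 0 = f 2
  ge : ∀ d < 3, 1 ≤ K * f d
  sum : f 0 + f 1 + f 2 = 3

lemma cascade_child (f : ℕ → ℝ≥0) (n i : ℕ) {d : ℕ} (hd : d < 3) :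
    cascade f (n + 1) (3 * i + d) = cascade f n i * f d := by
  rw [cascade]
  congr 2 <;> omega

/-- Multiplicative functions of a cascade are cascades, so the means of negative powers and of
square roots follow from the same integral formula as the mean of the weight. -/
lemma cascade_map {g : ℝ≥0 → ℝ≥0} (h1 : g 1 = 1) (hmul : ∀ x y, g (x * y) = g x * g y)
    (f : ℕ → ℝ≥0) (n i : ℕ) : cascade (fun d => g (f d)) n i = g (cascade f n i) := by
  induction n generalizing i with
  | zero => simp [cascade, h1]
  | succ n ih => simp [cascade, ih, hmul]

lemma cascade_zero_right (f : ℕ → ℝ≥0) (n : ℕ) : cascade f n 0 = f 0 ^ n := by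
  induction n with
  | zero => simp [cascade]
  | succ n ih => simp [cascade, ih, pow_succ]

section

variable {f : ℕ → ℝ≥0} {K : ℝ≥0}

lemma IsBalanced.one_le (h : IsBalanced f K) : 1 ≤ K := le_trans (by norm_num) h.three_le

lemma IsBalanced.le_three (h : IsBalanced f K) {d : ℕ} (hd : d < 3) : f d ≤ 3 := by
  rw [← h.sum]
  obtain rfl | rfl | rfl : d = 0 ∨ d = 1 ∨ d = 2 := by omega
  · exact le_add_right le_self_add
  · exact le_add_right le_add_self
  · exact le_add_self

lemma IsBalanced.ratio (h : IsBalanced f K) {d e : ℕ} (hd : d < 3) (he : e < 3) :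
    f d ≤ K ^ 2 * f e :=
  calc f d ≤ K * 1 := by simpa using (h.le_three hd).trans h.three_le
    _ ≤ K * (K * f e) := by gcongr; exact h.ge e he
    _ = K ^ 2 * f e := by ring

lemma IsBalanced.pos (h : IsBalanced f K) {d : ℕ} (hd : d < 3) : 0 < f d := by
  have := h.ge d hd
  rcases eq_or_ne (f d) 0 with h0 | h0
  · simp [h0] at this
  · exact pos_iff_ne_zero.2 h0

lemma IsBalanced.cascade_pos (h : IsBalanced f K) (n i : ℕ) : 0 < cascade f n i := by
  induction n generalizing i with
  | zero => simp [cascade]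
  | succ n ih => exact mul_pos (ih _) (h.pos (Nat.mod_lt _ (by norm_num)))

/-- Without a carry the two indices share their parent and only the last factors differ. With a
carry the last digits are `2` and `0`, whose factors agree, and the comparison passes to the parents
at no cost. Thus the constant does not grow with `n`. -/
lemma IsBalanced.cascade_adjacent (h : IsBalanced f K) (n i : ℕ) :
    cascade f n i ≤ K ^ 2 * cascade f n (i + 1) ∧
      cascade f n (i + 1) ≤ K ^ 2 * cascade f n i := by
  induction n generalizing i with
  | zero => simpa [cascade] using one_le_pow₀ h.one_le
  | succ n ih =>
    have hlt : i % 3 < 3 := Nat.mod_lt _ (by norm_num)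
    have hlt' : (i + 1) % 3 < 3 := Nat.mod_lt _ (by norm_num)
    simp only [cascade]
    by_cases hi : i % 3 = 2
    · have h1 : (i + 1) / 3 = i / 3 + 1 := by omega
      have h2 : (i + 1) % 3 = 0 := by omega
      rw [h1, h2, hi, ← h.symm, ← mul_assoc, ← mul_assoc]
      exact ⟨mul_le_mul_left (ih _).1 _, mul_le_mul_left (ih _).2 _⟩
    · have h1 : (i + 1) / 3 = i / 3 := by omega
      rw [h1, mul_left_comm (K ^ 2), mul_left_comm (K ^ 2)]
      exact ⟨mul_le_mul_right (h.ratio hlt hlt') _, mul_le_mul_right (h.ratio hlt' hlt) _⟩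

end

/-! ### Cascade densities and their comparison at nearby points and generations -/

/-- The density with respect to Lebesgue measure of the cascade with digit factors `f`, refined
down to the scale `3⁻ⁿ`. -/
noncomputable def cascadeDensity (f : ℕ → ℝ≥0) (n : ℕ) (x : ℝ) : ℝ≥0 := cascade f n ⌊3 ^ n * x⌋₊

lemma floor_three_pow_succ (n : ℕ) (x : ℝ) : ⌊3 ^ (n + 1) * x⌋₊ / 3 = ⌊3 ^ n * x⌋₊ := by
  rw [← Nat.floor_div_ofNat]
  congr 1
  rw [pow_succ]
  ring

lemma cascadeDensity_succ (f : ℕ → ℝ≥0) (n : ℕ) (x : ℝ) :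
    cascadeDensity f (n + 1) x = cascadeDensity f n x * f (⌊3 ^ (n + 1) * x⌋₊ % 3) := by
  simp [cascadeDensity, cascade, floor_three_pow_succ]

lemma measurable_cascadeDensity (f : ℕ → ℝ≥0) (n : ℕ) : Measurable (cascadeDensity f n) := by
  have h : Measurable fun x : ℝ => ⌊3 ^ n * x⌋₊ :=
    Nat.measurable_floor.comp (measurable_const.mul measurable_id)
  exact (measurable_from_top (f := cascade f n)).comp h

section

variable {f : ℕ → ℝ≥0} {K : ℝ≥0}

lemma IsBalanced.cascadeDensity_succ_le (h : IsBalanced f K) (n : ℕ) (x : ℝ) :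
    cascadeDensity f (n + 1) x ≤ 3 * cascadeDensity f n x := by
  rw [cascadeDensity_succ, mul_comm]
  exact mul_le_mul_left (h.le_three (Nat.mod_lt _ (by norm_num))) _

lemma IsBalanced.le_cascadeDensity_succ (h : IsBalanced f K) (n : ℕ) (x : ℝ) :
    cascadeDensity f n x ≤ K * cascadeDensity f (n + 1) x := by
  rw [cascadeDensity_succ, mul_left_comm]
  exact le_mul_of_one_le_right' (h.ge _ (Nat.mod_lt _ (by norm_num)))

lemma IsBalanced.cascadeDensity_add_le (h : IsBalanced f K) (n m : ℕ) (x : ℝ) :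
    cascadeDensity f (n + m) x ≤ 3 ^ m * cascadeDensity f n x := by
  induction m with
  | zero => simp
  | succ m ih =>
    calc cascadeDensity f (n + m + 1) x ≤ 3 * cascadeDensity f (n + m) x :=
          h.cascadeDensity_succ_le _ _
      _ ≤ 3 * (3 ^ m * cascadeDensity f n x) := by gcongr
      _ = 3 ^ (m + 1) * cascadeDensity f n x := by ring

lemma IsBalanced.le_cascadeDensity_add (h : IsBalanced f K) (n m : ℕ) (x : ℝ) :
    cascadeDensity f n x ≤ K ^ m * cascadeDensity f (n + m) x := by
  induction m with
  | zero => simp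
  | succ m ih =>
    calc cascadeDensity f n x ≤ K ^ m * cascadeDensity f (n + m) x := ih
      _ ≤ K ^ m * (K * cascadeDensity f (n + m + 1) x) := by
          gcongr; exact h.le_cascadeDensity_succ _ _
      _ = K ^ (m + 1) * cascadeDensity f (n + (m + 1)) x := by rw [← add_assoc]; ring

lemma natFloor_le_add_one {u v : ℝ} (hv : 0 ≤ v) (h : u ≤ v + 1) : ⌊u⌋₊ ≤ ⌊v⌋₊ + 1 := by
  rw [← Nat.floor_add_one hv]
  exact Nat.floor_le_floor h

lemma IsBalanced.cascadeDensity_le_of_near (h : IsBalanced f K) {n : ℕ} {x y : ℝ} (hx : 0 ≤ x)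
    (hy : 0 ≤ y) (hxy : 3 ^ n * |x - y| ≤ 1) :
    cascadeDensity f n x ≤ K ^ 2 * cascadeDensity f n y := by
  have h3 : (0 : ℝ) < 3 ^ n := by positivity
  rw [← abs_of_pos h3, ← abs_mul, mul_sub, abs_le] at hxy
  have h1 := natFloor_le_add_one (u := 3 ^ n * x) (v := 3 ^ n * y) (by positivity) (by linarith)
  have h2 := natFloor_le_add_one (u := 3 ^ n * y) (v := 3 ^ n * x) (by positivity) (by linarith)
  unfold cascadeDensity
  generalize ⌊3 ^ n * x⌋₊ = i at *
  generalize ⌊3 ^ n * y⌋₊ = j at *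
  obtain h | rfl | h' : i = j ∨ i = j + 1 ∨ j = i + 1 := by omega
  · subst h
    exact le_mul_of_one_le_left' (one_le_pow₀ h.one_le)
  · exact (h.cascade_adjacent n j).2
  · subst h'
    exact (h.cascade_adjacent n i).1

lemma IsBalanced.cascadeDensity_le (h : IsBalanced f K) {n m : ℕ} {x y : ℝ} (hx : 0 ≤ x)
    (hy : 0 ≤ y) (hnm : n ≤ m + 2) (hmn : m ≤ n + 2) (hxy : 3 ^ (min n m) * |x - y| ≤ 1) :
    cascadeDensity f n x ≤ K ^ 4 * cascadeDensity f m y := by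
  have hK : ∀ k ≤ 2, K ^ k ≤ K ^ 2 := fun k hk => pow_le_pow_right₀ h.one_le hk
  rcases le_total n m with hle | hle
  · obtain ⟨k, rfl⟩ := Nat.exists_eq_add_of_le hle
    rw [min_eq_left hle] at hxy
    calc cascadeDensity f n x ≤ K ^ 2 * cascadeDensity f n y :=
          h.cascadeDensity_le_of_near hx hy hxy
      _ ≤ K ^ 2 * (K ^ 2 * cascadeDensity f (n + k) y) := by
          gcongr
          exact (h.le_cascadeDensity_add n k y).trans (mul_le_mul_left (hK k (by omega)) _)
      _ = K ^ 4 * cascadeDensity f (n + k) y := by ring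
  · obtain ⟨k, rfl⟩ := Nat.exists_eq_add_of_le hle
    rw [min_eq_right hle] at hxy
    calc cascadeDensity f (m + k) x ≤ K ^ 2 * cascadeDensity f m x :=
          (h.cascadeDensity_add_le m k x).trans (mul_le_mul_left
            ((pow_le_pow_left₀ (by norm_num) h.three_le k).trans (hK k (by omega))) _)
      _ ≤ K ^ 2 * (K ^ 2 * cascadeDensity f m y) := by
          gcongr
          exact h.cascadeDensity_le_of_near hx hy hxy
      _ = K ^ 4 * cascadeDensity f m y := by ring

end

/-! ### Triadic intervals -/

/-- The triadic interval `[i 3⁻ⁿ, (i + 1) 3⁻ⁿ)`. -/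
def triadic (n i : ℕ) : Set ℝ := Ico (i / 3 ^ n) ((i + 1) / 3 ^ n)

lemma mem_triadic {n i : ℕ} {x : ℝ} : x ∈ triadic n i ↔ 0 ≤ x ∧ ⌊3 ^ n * x⌋₊ = i := by
  have h3 : (0 : ℝ) < 3 ^ n := by positivity
  rw [triadic, mem_Ico, div_le_iff₀ h3, lt_div_iff₀ h3, mul_comm x]
  constructor
  · rintro ⟨h1, h2⟩
    have h0 : (0 : ℝ) ≤ 3 ^ n * x := le_trans (by positivity) h1
    exact ⟨nonneg_of_mul_nonneg_right h0 h3, (Nat.floor_eq_iff h0).2 ⟨h1, h2⟩⟩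
  · rintro ⟨h0, h⟩
    exact (Nat.floor_eq_iff (by positivity)).1 h

lemma measurableSet_triadic (n i : ℕ) : MeasurableSet (triadic n i) := measurableSet_Ico

lemma volume_triadic (n i : ℕ) : volume (triadic n i) = (3 ^ n)⁻¹ := by
  rw [triadic, Real.volume_Ico, ← sub_div, add_sub_cancel_left, one_div, ENNReal.ofReal_inv_of_pos
    (by positivity), ENNReal.ofReal_pow (by norm_num)]
  simp

lemma triadic_eq_union (n i : ℕ) : triadic n i =
    (triadic (n + 1) (3 * i) ∪ triadic (n + 1) (3 * i + 1)) ∪ triadic (n + 1) (3 * i + 2) := by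
  ext x
  simp only [mem_union, mem_triadic]
  rw [← floor_three_pow_succ]
  generalize ⌊3 ^ (n + 1) * x⌋₊ = k
  constructor
  · rintro ⟨h0, h⟩
    obtain h | h | h : k = 3 * i ∨ k = 3 * i + 1 ∨ k = 3 * i + 2 := by omega
    all_goals simp [h0, h]
  · rintro ((⟨h0, h⟩ | ⟨h0, h⟩) | ⟨h0, h⟩)
    all_goals exact ⟨h0, by omega⟩

lemma disjoint_triadic {n i j : ℕ} (hij : i ≠ j) : Disjoint (triadic n i) (triadic n j) := by
  rw [Set.disjoint_left]
  intro x hi hj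
  exact hij ((mem_triadic.1 hi).2.symm.trans (mem_triadic.1 hj).2)

lemma lintegral_triadic (g : ℝ → ℝ≥0∞) (n i : ℕ) : ∫⁻ x in triadic n i, g x =
    (∫⁻ x in triadic (n + 1) (3 * i), g x) + (∫⁻ x in triadic (n + 1) (3 * i + 1), g x) +
      ∫⁻ x in triadic (n + 1) (3 * i + 2), g x := by
  rw [triadic_eq_union, lintegral_union (measurableSet_triadic _ _),
    lintegral_union (measurableSet_triadic _ _)]
  · exact disjoint_triadic (by omega)
  · exact Disjoint.union_left (disjoint_triadic (by omega)) (disjoint_triadic (by omega))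

/-- Each refinement multiplies the integral by the mean of the factors. No normalisation is assumed,
so that the formula also applies to powers of the factors. -/
lemma lintegral_cascadeDensity (f : ℕ → ℝ≥0) (m n i : ℕ) :
    ∫⁻ x in triadic n i, cascadeDensity f (n + m) x =
      ((f 0 + f 1 + f 2) / 3 : ℝ≥0) ^ m * cascade f n i * (3 ^ n)⁻¹ := by
  induction m generalizing n i with
  | zero =>
    rw [setLIntegral_congr_fun (g := fun _ => (cascade f n i : ℝ≥0∞)) (measurableSet_triadic n i),
      setLIntegral_const, volume_triadic]
    · simp
    · intro x hx
      simp [cascadeDensity, (mem_triadic.1 hx).2]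
  | succ m ih =>
    have ih' := fun j => ih (n + 1) j
    rw [show n + 1 + m = n + (m + 1) by ring] at ih'
    rw [lintegral_triadic, ih', ih', ih']
    have h0 := cascade_child f n i (d := 0) (by norm_num)
    rw [add_zero] at h0
    rw [h0, cascade_child f n i (by norm_num), cascade_child f n i (by norm_num)]
    have h3 : ∀ k, ((3 : ℝ≥0∞) ^ k)⁻¹ = (((3 : ℝ≥0)⁻¹ ^ k : ℝ≥0) : ℝ≥0∞) := fun k => by
      rw [inv_pow, ENNReal.coe_inv (by positivity)]
      simp
    rw [h3, h3]
    norm_cast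
    rw [pow_succ, pow_succ, div_eq_mul_inv]
    ring

/-! ### Levels and the stopped cascade -/

/-- The number `j` with `3⁻ʲ ≤ |x| < 3¹⁻ʲ` for `0 < |x| < 1`, and `0` for other `x`. -/
noncomputable def level (x : ℝ) : ℕ := Nat.clog 3 ⌈|x|⁻¹⌉₊

lemma level_le_iff_inv {x : ℝ} {j : ℕ} : level x ≤ j ↔ |x|⁻¹ ≤ 3 ^ j := by
  rw [level, Nat.clog_le_iff_le_pow (by norm_num), Nat.ceil_le]
  simp

lemma level_le_iff {x : ℝ} (hx : 0 < x) {j : ℕ} : level x ≤ j ↔ 1 ≤ 3 ^ j * x := by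
  rw [level_le_iff_inv, abs_of_pos hx, inv_le_iff_one_le_mul₀ hx]

lemma level_neg (x : ℝ) : level (-x) = level x := by simp [level]

lemma level_abs (x : ℝ) : level |x| = level x := by simp [level]

lemma level_eq_zero {x : ℝ} (hx : 1 ≤ |x|) : level x = 0 := by
  rw [← Nat.le_zero, level_le_iff_inv, pow_zero]
  exact inv_le_one_of_one_le₀ hx

lemma measurable_level : Measurable level := by
  have h : Measurable fun x : ℝ => ⌈|x|⁻¹⌉₊ := Nat.measurable_ceil.comp (by fun_prop)
  exact (measurable_from_top (f := Nat.clog 3)).comp h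

lemma level_le_level_add_one {x y : ℝ} (hx : 0 < x) (hy : 0 < y) (h : y ≤ 3 * x) :
    level x ≤ level y + 1 := by
  rw [level_le_iff hx, pow_succ]
  have := (level_le_iff hy).1 le_rfl
  nlinarith [pow_pos (show (0 : ℝ) < 3 by norm_num) (level y)]

lemma level_anti {x y : ℝ} (hx : 0 < x) (h : x ≤ y) : level y ≤ level x := by
  rw [level_le_iff (hx.trans_le h)]
  have := (level_le_iff hx).1 le_rfl
  nlinarith [pow_pos (show (0 : ℝ) < 3 by norm_num) (level x)]

/-- The level jumps only at the points `3⁻ʲ`. For `j ≤ n` these are endpoints of intervals of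
generation `n`, and for `j > n` they lie in the interval at the origin, which `1 ≤ i` excludes. -/
lemma level_eq_of_mem_triadic {n i : ℕ} (hi : 1 ≤ i) {x : ℝ} (hx : x ∈ triadic n i) :
    level x = level (i / 3 ^ n) := by
  have h3 : (0 : ℝ) < 3 ^ n := by positivity
  have hi0 : (0 : ℝ) < i := by exact_mod_cast hi
  have h0 : (0 : ℝ) < i / 3 ^ n := by positivity
  refine le_antisymm (level_anti h0 hx.1) ?_
  rw [level_le_iff h0, ← mul_div_assoc, one_le_div h3]
  have h1 := (level_le_iff (h0.trans_le hx.1)).1 le_rfl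
  rcases le_total n (level x) with hle | hle
  · calc (3 : ℝ) ^ n ≤ 3 ^ level x := pow_le_pow_right₀ (by norm_num) hle
      _ ≤ 3 ^ level x * i := le_mul_of_one_le_right (by positivity) (by exact_mod_cast hi)
  · obtain ⟨k, hk⟩ := Nat.exists_eq_add_of_le hle
    have h2 : x < (i + 1) / 3 ^ n := hx.2
    rw [lt_div_iff₀ h3, hk, pow_add] at h2
    have h4 : (3 : ℝ) ^ k < i + 1 := by
      refine lt_of_le_of_lt ?_ h2
      nlinarith [pow_pos (show (0 : ℝ) < 3 by norm_num) k]
    have h5 : 3 ^ k ≤ i := by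
      rw [← Nat.lt_succ_iff]
      exact_mod_cast h4
    rw [hk, pow_add]
    gcongr
    exact_mod_cast h5

lemma level_div_pow {n i : ℕ} (h1 : 1 ≤ i) (h2 : i < 3) : level (i / 3 ^ n) = n := by
  have h3 : (0 : ℝ) < 3 ^ n := by positivity
  have hi0 : (0 : ℝ) < i := by exact_mod_cast h1
  have h0 : (0 : ℝ) < i / 3 ^ n := by positivity
  refine le_antisymm ?_ ?_
  · rw [level_le_iff h0, mul_div_cancel₀ _ h3.ne']
    exact_mod_cast h1
  · by_contra! hlt
    have hle : level (i / 3 ^ n) + 1 ≤ n := hlt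
    have h4 := (level_le_iff h0).1 (le_refl (level (i / 3 ^ n)))
    rw [← mul_div_assoc, one_le_div h3] at h4
    have h5 := pow_le_pow_right₀ (show (1 : ℝ) ≤ 3 by norm_num) hle
    rw [pow_succ] at h5
    have h6 : (i : ℝ) < 3 := by exact_mod_cast h2
    nlinarith [pow_pos (show (0 : ℝ) < 3 by norm_num) (level (i / 3 ^ n))]

/-- The cascade stopped at the generation `2 j` at the points of level `j`. -/
noncomputable def stoppedDensity (f : ℕ → ℝ≥0) (x : ℝ) : ℝ≥0 :=
  cascadeDensity f (2 * level x) |x|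

lemma stoppedDensity_neg (f : ℕ → ℝ≥0) (x : ℝ) : stoppedDensity f (-x) = stoppedDensity f x := by
  simp [stoppedDensity, level_neg]

lemma stoppedDensity_of_one_le (f : ℕ → ℝ≥0) {x : ℝ} (hx : 1 ≤ |x|) : stoppedDensity f x = 1 := by
  simp [stoppedDensity, level_eq_zero hx, cascadeDensity, cascade]

lemma measurable_stoppedDensity (f : ℕ → ℝ≥0) : Measurable (stoppedDensity f) := by
  have h : Measurable fun q : ℕ × ℝ => cascadeDensity f (2 * q.1) |q.2| :=
    measurable_from_prod_countable_right
      fun n => (measurable_cascadeDensity f (2 * n)).comp (by fun_prop)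
  exact h.comp (measurable_level.prodMk measurable_id)

lemma cascadeDensity_div (f : ℕ → ℝ≥0) (n i : ℕ) :
    cascadeDensity f n (i / 3 ^ n) = cascade f n i := by
  rw [cascadeDensity, mul_div_cancel₀ _ (by positivity), Nat.floor_natCast]

lemma floor_eq_of_mem_triadic {n m i : ℕ} (hmn : m ≤ n) {x : ℝ} (hx : x ∈ triadic n i) :
    ⌊3 ^ m * x⌋₊ = i / 3 ^ (n - m) := by
  obtain ⟨k, rfl⟩ := Nat.exists_eq_add_of_le hmn
  rw [← (mem_triadic.1 hx).2, add_tsub_cancel_left]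
  have := Nat.floor_div_natCast (3 ^ (m + k) * x : ℝ) (3 ^ k)
  rw [← this]
  congr 1
  push_cast
  rw [pow_add]
  field_simp

/-! ### Mass of the stopped cascade on triadic intervals -/

section

variable {f : ℕ → ℝ≥0} {K : ℝ≥0}

lemma left_mem_triadic (n i : ℕ) : (i / 3 ^ n : ℝ) ∈ triadic n i :=
  ⟨le_rfl, by gcongr; linarith⟩

lemma IsBalanced.mean (h : IsBalanced f K) : (f 0 + f 1 + f 2) / 3 = 1 := by
  rw [h.sum, div_self (by norm_num)]

/-- The mass which the stopped cascade gives to a triadic interval. -/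
noncomputable def triadicMass (f : ℕ → ℝ≥0) (n i : ℕ) : ℝ≥0∞ :=
  ∫⁻ x in triadic n i, stoppedDensity f x

/-- Away from the origin the level is constant on the interval. Generations after `n` preserve the
mass because the factors have mean one; if the stopping generation comes before `n`, the density is
constant there. -/
lemma IsBalanced.triadicMass_eq (h : IsBalanced f K) (n : ℕ) {i : ℕ} (hi : 1 ≤ i) :
    triadicMass f n i =
      cascadeDensity f (min n (2 * level (i / 3 ^ n))) (i / 3 ^ n) * (3 ^ n)⁻¹ := by
  have hcongr : ∀ x ∈ triadic n i, (stoppedDensity f x : ℝ≥0∞) =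
      cascadeDensity f (2 * level (i / 3 ^ n)) x := fun x hx => by
    rw [stoppedDensity, level_eq_of_mem_triadic hi hx, abs_of_nonneg (mem_triadic.1 hx).1]
  rw [triadicMass, setLIntegral_congr_fun (measurableSet_triadic n i) hcongr]
  rcases le_total n (2 * level (i / 3 ^ n)) with hle | hle
  · rw [min_eq_left hle]
    obtain ⟨m, hm⟩ := Nat.exists_eq_add_of_le hle
    rw [hm, lintegral_cascadeDensity, h.mean, cascadeDensity_div]
    simp
  · rw [min_eq_right hle, setLIntegral_congr_fun (measurableSet_triadic n i)
      (g := fun _ => (cascadeDensity f (2 * level (i / 3 ^ n)) (i / 3 ^ n) : ℝ≥0∞)),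
      setLIntegral_const, volume_triadic]
    intro x hx
    simp only [cascadeDensity]
    rw [floor_eq_of_mem_triadic hle hx, floor_eq_of_mem_triadic hle (left_mem_triadic n i)]

lemma IsBalanced.triadicMass_of_lt (h : IsBalanced f K) (n : ℕ) {i : ℕ} (h1 : 1 ≤ i) (h3 : i < 3) :
    triadicMass f n i = cascade f n i * (3 ^ n)⁻¹ := by
  rw [h.triadicMass_eq n h1, level_div_pow h1 h3, min_eq_left (by omega), cascadeDensity_div]

/-- The interval at the origin meets every level above `n`, so no single generation describes it.
Its part of level `j` lies in the two intervals of generation `j` with indices `1` and `2`, and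
these masses decay geometrically. -/
lemma IsBalanced.triadicMass_zero_le (h : IsBalanced f K) (n : ℕ) :
    triadicMass f n 0 ≤ 2 * (cascade f n 0 * (3 ^ n)⁻¹) := by
  have hcover : triadic n 0 ⊆
      {0} ∪ ⋃ j : ℕ, (triadic (n + 1 + j) 1 ∪ triadic (n + 1 + j) 2) := by
    intro x hx
    have h3 : (0 : ℝ) < 3 ^ n := by positivity
    rcases (mem_triadic.1 hx).1.eq_or_lt with h0 | h0
    · exact Or.inl h0.symm
    right
    have hx2 : 3 ^ n * x < 1 := Nat.floor_eq_zero.1 (mem_triadic.1 hx).2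
    have hlev : n + 1 ≤ level x := by
      rw [Nat.succ_le_iff, ← not_le, level_le_iff h0, not_le]
      exact hx2
    obtain ⟨j, hj⟩ := Nat.exists_eq_add_of_le hlev
    have hl : 1 ≤ 3 ^ level x * x := (level_le_iff h0).1 le_rfl
    have hu : 3 ^ level x * x < 3 := by
      have : ¬ level x ≤ n + j := by omega
      rw [level_le_iff h0, not_le] at this
      rw [show level x = n + j + 1 by omega, pow_succ]
      linarith
    rw [mem_iUnion]
    refine ⟨j, ?_⟩
    simp only [mem_union, mem_triadic, ← hj]
    have f1 : 1 ≤ ⌊3 ^ level x * x⌋₊ := Nat.le_floor (by simpa using hl)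
    have f2 : ⌊3 ^ level x * x⌋₊ < 3 := (Nat.floor_lt (by positivity)).2 (by simpa using hu)
    generalize ⌊3 ^ level x * x⌋₊ = k at *
    obtain rfl | rfl : k = 1 ∨ k = 2 := by omega
    · exact Or.inl ⟨h0.le, rfl⟩
    · exact Or.inr ⟨h0.le, rfl⟩
  set ν : Measure ℝ := volume.withDensity fun x => (stoppedDensity f x : ℝ≥0∞)
  have hm : ∀ k i, ν (triadic k i) = triadicMass f k i := fun k i =>
    withDensity_apply _ (measurableSet_triadic _ _)
  have hν0 : ν {0} = 0 := withDensity_absolutelyContinuous _ _ Real.volume_singleton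
  have hinv : ∀ k, ((3 : ℝ≥0∞) ^ k)⁻¹ = (((3 : ℝ≥0)⁻¹ ^ k : ℝ≥0) : ℝ≥0∞) := fun k => by
    rw [inv_pow, ENNReal.coe_inv (by positivity)]
    simp
  -- Since `f 0 = f 2` and the three factors sum to `3`, `f 0 ≤ 3 / 2`; this gives the ratio of the
  -- geometric series.
  have hf0 : f 0 * 3⁻¹ ≤ 2⁻¹ := by
    have h2 : f 0 * 2 ≤ 3 := by
      rw [← h.sum, ← h.symm, mul_two]
      exact add_le_add_left (le_self_add) _
    rw [← div_eq_mul_inv, div_le_iff₀ (by norm_num),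
      ← mul_le_mul_iff_left₀ (show (0 : ℝ≥0) < 2 by norm_num)]
    refine h2.trans (le_of_eq ?_)
    norm_num
  have hterm : ∀ j, ν (triadic (n + 1 + j) 1 ∪ triadic (n + 1 + j) 2) ≤
      (cascade f n 0 * (3 ^ n)⁻¹) * 2⁻¹ ^ j := by
    intro j
    refine (measure_union_le _ _).trans ?_
    have e1 := cascade_child f (n + j) 0 (d := 1) (by norm_num)
    have e2 := cascade_child f (n + j) 0 (d := 2) (by norm_num)
    rw [mul_zero, zero_add, cascade_zero_right] at e1 e2
    rw [hm, hm, h.triadicMass_of_lt _ le_rfl (by norm_num),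
      h.triadicMass_of_lt _ (by norm_num) (by norm_num), show n + 1 + j = n + j + 1 by ring, e1, e2,
      cascade_zero_right, hinv, hinv, show (2⁻¹ : ℝ≥0∞) = ((2⁻¹ : ℝ≥0) : ℝ≥0∞) by simp]
    norm_cast
    calc f 0 ^ (n + j) * f 1 * 3⁻¹ ^ (n + j + 1) + f 0 ^ (n + j) * f 2 * 3⁻¹ ^ (n + j + 1)
        = (f 1 + f 2) * 3⁻¹ * (f 0 ^ n * 3⁻¹ ^ n * (f 0 * 3⁻¹) ^ j) := by
          rw [mul_pow]; ring
      _ ≤ 1 * (f 0 ^ n * 3⁻¹ ^ n * 2⁻¹ ^ j) := by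
          gcongr
          rw [← div_eq_mul_inv, div_le_one (by norm_num), ← h.sum, add_assoc]
          exact le_add_self
      _ = f 0 ^ n * 3⁻¹ ^ n * 2⁻¹ ^ j := one_mul _
  calc triadicMass f n 0 = ν (triadic n 0) := (hm _ _).symm
    _ ≤ ν {0} + ν (⋃ j : ℕ, (triadic (n + 1 + j) 1 ∪ triadic (n + 1 + j) 2)) :=
        (measure_mono hcover).trans (measure_union_le _ _)
    _ ≤ ∑' j, ν (triadic (n + 1 + j) 1 ∪ triadic (n + 1 + j) 2) := by
        rw [hν0, zero_add]; exact measure_iUnion_le _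
    _ ≤ ∑' j : ℕ, (cascade f n 0 * (3 ^ n)⁻¹) * (2⁻¹ : ℝ≥0∞) ^ j := ENNReal.tsum_le_tsum hterm
    _ = 2 * (cascade f n 0 * (3 ^ n)⁻¹) := by
        rw [ENNReal.tsum_mul_left, ENNReal.tsum_geometric, ENNReal.one_sub_inv_two, inv_inv,
          mul_comm]

/-- For `i ≥ 1` the levels of neighbours differ by at most one, hence the stopping generations by at
most two, and `IsBalanced.cascadeDensity_le` applies. The interval at the origin is treated
separately. -/
lemma IsBalanced.triadicMass_adjacent (h : IsBalanced f K) (n i : ℕ) :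
    triadicMass f n i ≤ (3 * K ^ 4 : ℝ≥0) * triadicMass f n (i + 1) ∧
      triadicMass f n (i + 1) ≤ (3 * K ^ 4 : ℝ≥0) * triadicMass f n i := by
  rcases Nat.eq_zero_or_pos i with rfl | hi
  · have hK2 : K ^ 2 ≤ K ^ 4 := pow_le_pow_right₀ h.one_le (by norm_num)
    have hK3 : K ^ 3 ≤ K ^ 4 := pow_le_pow_right₀ h.one_le (by norm_num)
    have h1 := h.triadicMass_of_lt n (i := 1) le_rfl (by norm_num)
    constructor
    · refine (h.triadicMass_zero_le n).trans ?_
      rw [zero_add, h1, ← mul_assoc, ← mul_assoc]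
      refine mul_le_mul_left ?_ _
      norm_cast
      calc 2 * cascade f n 0 ≤ 3 * (K ^ 2 * cascade f n 1) := by
            gcongr
            · norm_num
            · exact (h.cascade_adjacent n 0).1
        _ ≤ 3 * (K ^ 4 * cascade f n 1) := by gcongr
        _ = 3 * K ^ 4 * cascade f n 1 := by ring
    -- The middle child of the interval at the origin has an exactly known mass, which bounds that
    -- of the whole from below.
    · have hsub : triadicMass f (n + 1) 1 ≤ triadicMass f n 0 := by
        have : triadic (n + 1) 1 ⊆ triadic n 0 := by
          rw [triadic_eq_union n 0]
          exact fun x hx => Or.inl (Or.inr hx)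
        exact lintegral_mono_set this
      refine le_trans ?_ (mul_le_mul_right hsub _)
      rw [zero_add, h1, h.triadicMass_of_lt _ (i := 1) le_rfl (by norm_num)]
      have e1 := cascade_child f n 0 (d := 1) (by norm_num)
      rw [mul_zero, zero_add] at e1
      have hinv : ((3 : ℝ≥0∞) ^ n)⁻¹ = 3 * (3 ^ (n + 1))⁻¹ := by
        rw [pow_succ, ENNReal.mul_inv (by simp) (by simp), mul_left_comm,
          ENNReal.mul_inv_cancel (by simp) (by simp), mul_one]
      rw [e1, hinv, ← mul_assoc, ← mul_assoc]
      refine mul_le_mul_left ?_ _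
      norm_cast
      calc cascade f n 1 * 3 ≤ K ^ 2 * cascade f n 0 * 3 := by
            gcongr; exact (h.cascade_adjacent n 0).2
        _ = K ^ 2 * cascade f n 0 * 3 * 1 := by ring
        _ ≤ K ^ 2 * cascade f n 0 * 3 * (K * f 1) := by gcongr; exact h.ge 1 (by norm_num)
        _ = 3 * K ^ 3 * (cascade f n 0 * f 1) := by ring
        _ ≤ 3 * K ^ 4 * (cascade f n 0 * f 1) := by gcongr
  · have h3 : (0 : ℝ) < 3 ^ n := by positivity
    have hi0 : (0 : ℝ) < i := by exact_mod_cast hi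
    have hi1 : (1 : ℝ) ≤ i := by exact_mod_cast hi
    have hx0 : (0 : ℝ) < i / 3 ^ n := by positivity
    have hy0 : (0 : ℝ) < (i + 1 : ℕ) / 3 ^ n := by positivity
    have hd : |(i : ℝ) / 3 ^ n - (i + 1 : ℕ) / 3 ^ n| = (3 ^ n)⁻¹ := by
      rw [← sub_div, abs_div, abs_of_pos h3]
      push_cast
      simp
    have hl1 : level ((i + 1 : ℕ) / 3 ^ n) ≤ level (i / 3 ^ n) := by
      refine level_anti hx0 ?_
      gcongr
      simp
    have hl2 : level (i / 3 ^ n) ≤ level ((i + 1 : ℕ) / 3 ^ n) + 1 := by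
      refine level_le_level_add_one hx0 hy0 ?_
      rw [← mul_div_assoc]
      gcongr
      push_cast
      linarith
    have hmin : ∀ k ≤ n, (3 : ℝ) ^ k * (3 ^ n)⁻¹ ≤ 1 := fun k hk => by
      rw [← div_eq_mul_inv, div_le_one h3]
      exact pow_le_pow_right₀ (by norm_num) hk
    have hK : K ^ 4 ≤ 3 * K ^ 4 := le_mul_of_one_le_left' (by norm_num)
    rw [h.triadicMass_eq n hi, h.triadicMass_eq n (Nat.le_add_left 1 i), ← mul_assoc, ← mul_assoc]
    constructor
    · refine mul_le_mul_left ?_ _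
      rw [← ENNReal.coe_mul, ENNReal.coe_le_coe]
      refine (h.cascadeDensity_le hx0.le hy0.le (n := min n (2 * level (i / 3 ^ n)))
        (m := min n (2 * level ((i + 1 : ℕ) / 3 ^ n)))
        (by omega) (by omega) ?_).trans (mul_le_mul_left hK _)
      rw [hd]
      exact hmin _ (by omega)
    · refine mul_le_mul_left ?_ _
      rw [← ENNReal.coe_mul, ENNReal.coe_le_coe]
      refine (h.cascadeDensity_le hy0.le hx0.le
        (n := min n (2 * level ((i + 1 : ℕ) / 3 ^ n))) (m := min n (2 * level (i / 3 ^ n)))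
        (by omega) (by omega) ?_).trans (mul_le_mul_left hK _)
      rw [abs_sub_comm, hd]
      exact hmin _ (by omega)

end

/-! ### The doubling property -/

/-- The measure whose density is the stopped cascade. -/
noncomputable def stoppedMeasure (f : ℕ → ℝ≥0) : Measure ℝ :=
  weightMeasure fun x => stoppedDensity f x

lemma stoppedMeasure_apply (f : ℕ → ℝ≥0) (s : Set ℝ) :
    stoppedMeasure f s = ∫⁻ x in s, stoppedDensity f x := by
  rw [stoppedMeasure, weightMeasure, withDensity_apply']
  simp

lemma stoppedMeasure_preimage_neg (f : ℕ → ℝ≥0) {s : Set ℝ} (hs : MeasurableSet s) :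
    stoppedMeasure f (Neg.neg ⁻¹' s) = stoppedMeasure f s := by
  rw [stoppedMeasure_apply, stoppedMeasure_apply]
  have := (Measure.measurePreserving_neg (volume : Measure ℝ)).setLIntegral_comp_preimage hs
    (f := fun x => (stoppedDensity f x : ℝ≥0∞)) (measurable_stoppedDensity f).coe_nnreal_ennreal
  simpa only [stoppedDensity_neg] using this

lemma stoppedMeasure_le {f : ℕ → ℝ≥0} {B : ℝ≥0} {s : Set ℝ} (hs : MeasurableSet s)
    (hB : ∀ x ∈ s, x ≠ 0 → stoppedDensity f x ≤ B) : stoppedMeasure f s ≤ B * volume s := by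
  rw [stoppedMeasure_apply, ← setLIntegral_const]
  refine setLIntegral_mono_ae' hs ?_
  filter_upwards [Measure.ae_ne volume (0 : ℝ)] with x hx0 hx
  exact_mod_cast hB x hx hx0

lemma le_stoppedMeasure {f : ℕ → ℝ≥0} {B : ℝ≥0} {s : Set ℝ} (hs : MeasurableSet s)
    (hB : ∀ x ∈ s, B ≤ stoppedDensity f x) : B * volume s ≤ stoppedMeasure f s := by
  rw [stoppedMeasure_apply, ← setLIntegral_const]
  exact setLIntegral_mono' hs fun x hx => by exact_mod_cast hB x hx

/-- The density is one outside `closedBall 0 1`, so the mass is at least `2 * r - 2 ≥ r`. -/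
lemma le_stoppedMeasure_closedBall (f : ℕ → ℝ≥0) (c : ℝ) {r : ℝ} (hr : 2 ≤ r) :
    ENNReal.ofReal r ≤ stoppedMeasure f (closedBall c r) := by
  have hm : MeasurableSet (closedBall c r \ closedBall 0 1) :=
    measurableSet_closedBall.diff measurableSet_closedBall
  calc ENNReal.ofReal r ≤ volume (closedBall c r) - volume (closedBall (0 : ℝ) 1) := by
        rw [Real.volume_closedBall, Real.volume_closedBall,
          ← ENNReal.ofReal_sub _ (by norm_num)]
        exact ENNReal.ofReal_le_ofReal (by linarith)
    _ ≤ volume (closedBall c r \ closedBall 0 1) := le_measure_sdiff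
    _ ≤ stoppedMeasure f (closedBall c r \ closedBall 0 1) := by
        have := le_stoppedMeasure (f := f) (B := 1) hm fun x hx => by
          rw [stoppedDensity_of_one_le]
          have := hx.2
          rw [mem_closedBall, dist_zero_right, Real.norm_eq_abs, not_le] at this
          exact this.le
        simpa using this
    _ ≤ stoppedMeasure f (closedBall c r) := measure_mono sdiff_subset

section

variable {f : ℕ → ℝ≥0} {K : ℝ≥0}

lemma IsBalanced.stoppedMeasure_triadic_le (h : IsBalanced f K) (n d : ℕ) {i k : ℕ}
    (h1 : i ≤ k + d) (h2 : k ≤ i + d) :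
    stoppedMeasure f (triadic n i) ≤
      ((3 * K ^ 4) ^ d : ℝ≥0) * stoppedMeasure f (triadic n k) := by
  rw [stoppedMeasure_apply, stoppedMeasure_apply]
  change triadicMass f n i ≤ ((3 * K ^ 4) ^ d : ℝ≥0) * triadicMass f n k
  have hD : (1 : ℝ≥0) ≤ 3 * K ^ 4 :=
    one_le_mul_of_one_le_of_one_le (by norm_num) (one_le_pow₀ h.one_le)
  induction d generalizing k with
  | zero =>
    obtain rfl : i = k := by omega
    simp
  | succ d ih =>
    have hstep : ∀ {j : ℕ}, triadicMass f n j ≤ (3 * K ^ 4 : ℝ≥0) * triadicMass f n k →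
        triadicMass f n i ≤ ((3 * K ^ 4) ^ d : ℝ≥0) * triadicMass f n j →
        triadicMass f n i ≤ ((3 * K ^ 4) ^ (d + 1) : ℝ≥0) * triadicMass f n k := by
      intro j h1 h2
      refine h2.trans ((mul_le_mul_right h1 _).trans (le_of_eq ?_))
      rw [← mul_assoc, pow_succ (3 * K ^ 4 : ℝ≥0) d]
      push_cast
      rfl
    rcases lt_trichotomy i k with hik | rfl | hik
    · obtain ⟨j, rfl⟩ := Nat.exists_eq_add_of_le' (show 1 ≤ k by omega)
      exact hstep (h.triadicMass_adjacent n j).1 (ih (by omega) (by omega))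
    · exact le_mul_of_one_le_left' (by exact_mod_cast one_le_pow₀ hD)
    · exact hstep (h.triadicMass_adjacent n k).2 (ih (by omega) (by omega))

lemma IsBalanced.stoppedMeasure_two_mul_le (h : IsBalanced f K) {c r : ℝ} (hc : 0 ≤ c)
    (hr : 0 < r) (hr2 : r ≤ 2) : stoppedMeasure f (closedBall c (2 * r)) ≤
      (54 * (3 * K ^ 4) ^ 13 : ℝ≥0) * stoppedMeasure f (closedBall c r) := by
  -- The scale is chosen so that `2 < 3 ^ n * r ≤ 6`: a triadic interval containing `c` then fits in
  -- `closedBall c r`, while the double ball has radius at most `12` triadic lengths.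
  obtain ⟨m, hm1, hm2⟩ := exists_nat_pow_near_of_lt_one (x := r / 2) (y := (1 / 3 : ℝ))
    (by linarith) (by linarith) (by norm_num) (by norm_num)
  set n := m + 1 with hn
  have h3 : (0 : ℝ) < 3 ^ n := by positivity
  have hlo : 2 < 3 ^ n * r := by
    rw [one_div, inv_pow, inv_lt_iff_one_lt_mul₀ h3] at hm1
    linarith
  have hhi : 3 ^ n * r ≤ 6 := by
    have h3' : (0 : ℝ) < 3 ^ m := by positivity
    rw [one_div, inv_pow, ← one_div, le_div_iff₀ h3'] at hm2
    rw [hn, pow_succ]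
    linarith
  set k := ⌊3 ^ n * c⌋₊ with hk
  have hk1 : (k : ℝ) ≤ 3 ^ n * c := Nat.floor_le (by positivity)
  have hk2 : 3 ^ n * c < k + 1 := Nat.lt_floor_add_one _
  have hin : triadic n k ⊆ closedBall c r := by
    intro x hx
    rw [triadic, mem_Ico, div_le_iff₀ h3, lt_div_iff₀ h3] at hx
    rw [mem_closedBall, Real.dist_eq, abs_le]
    constructor
    · refine le_of_mul_le_mul_left ?_ h3
      linarith
    · refine le_of_mul_le_mul_left ?_ h3
      linarith
  have hout : closedBall c (2 * r) ∩ Ici 0 ⊆ ⋃ i ∈ Finset.Icc (k - 13) (k + 13), triadic n i := by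
    rintro x ⟨hx, hx0⟩
    rw [mem_Ici] at hx0
    rw [mem_closedBall, Real.dist_eq, abs_le] at hx
    have hb1 := mul_le_mul_of_nonneg_left hx.1 h3.le
    have hb2 := mul_le_mul_of_nonneg_left hx.2 h3.le
    refine mem_biUnion (x := ⌊3 ^ n * x⌋₊) ?_ (mem_triadic.2 ⟨hx0, rfl⟩)
    have hf1 : (⌊3 ^ n * x⌋₊ : ℝ) ≤ 3 ^ n * x := Nat.floor_le (by positivity)
    have hf2 : 3 ^ n * x < ⌊3 ^ n * x⌋₊ + 1 := Nat.lt_floor_add_one _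
    have g1 : (⌊3 ^ n * x⌋₊ : ℝ) < (k + 14 : ℕ) := by push_cast; linarith
    have g2 : (k : ℝ) < (⌊3 ^ n * x⌋₊ + 14 : ℕ) := by push_cast; linarith
    rw [Nat.cast_lt] at g1 g2
    rw [Finset.mem_coe, Finset.mem_Icc]
    omega
  have hhalf : stoppedMeasure f (closedBall c (2 * r) ∩ Ici 0) ≤
      27 * (((3 * K ^ 4) ^ 13 : ℝ≥0) * stoppedMeasure f (closedBall c r)) := by
    calc stoppedMeasure f (closedBall c (2 * r) ∩ Ici 0)
        ≤ ∑ i ∈ Finset.Icc (k - 13) (k + 13), stoppedMeasure f (triadic n i) :=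
          (measure_mono hout).trans (measure_biUnion_finset_le _ _)
      _ ≤ ∑ i ∈ Finset.Icc (k - 13) (k + 13),
          ((3 * K ^ 4) ^ 13 : ℝ≥0) * stoppedMeasure f (closedBall c r) := by
          refine Finset.sum_le_sum fun i hi => ?_
          rw [Finset.mem_Icc] at hi
          exact (h.stoppedMeasure_triadic_le n 13 (by omega) (by omega)).trans
            (mul_le_mul_right (measure_mono hin) _)
      _ ≤ 27 * (((3 * K ^ 4) ^ 13 : ℝ≥0) * stoppedMeasure f (closedBall c r)) := by
          rw [Finset.sum_const, nsmul_eq_mul]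
          refine mul_le_mul_left ?_ _
          rw [Nat.card_Icc]
          have : k + 13 + 1 - (k - 13) ≤ 27 := by omega
          exact_mod_cast this
  -- As `c ≥ 0`, reflection maps the negative part of the ball into its nonnegative part.
  have hneg : stoppedMeasure f (closedBall c (2 * r) ∩ Iio 0) ≤
      stoppedMeasure f (closedBall c (2 * r) ∩ Ici 0) := by
    rw [← stoppedMeasure_preimage_neg f (measurableSet_closedBall.inter measurableSet_Iio)]
    refine measure_mono ?_
    rintro x ⟨hx, hx0⟩
    rw [mem_closedBall, Real.dist_eq, abs_le] at hx
    rw [mem_Iio, neg_lt_zero] at hx0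
    refine ⟨?_, hx0.le⟩
    rw [mem_closedBall, Real.dist_eq, abs_le]
    constructor <;> linarith
  calc stoppedMeasure f (closedBall c (2 * r))
      ≤ stoppedMeasure f (closedBall c (2 * r) ∩ Ici 0) +
        stoppedMeasure f (closedBall c (2 * r) ∩ Iio 0) := by
        refine (measure_mono ?_).trans (measure_union_le _ _)
        rw [← inter_union_distrib_left, Ici_union_Iio, inter_univ]
    _ ≤ _ := add_le_add hhalf (hneg.trans hhalf)
    _ = (54 * (3 * K ^ 4) ^ 13 : ℝ≥0) * stoppedMeasure f (closedBall c r) := by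
        rw [← two_mul, ← mul_assoc, ← mul_assoc]
        push_cast
        norm_num

lemma IsBalanced.isDoubling (h : IsBalanced f K) {B : ℝ≥0} (hB : ∀ x, stoppedDensity f x ≤ B) :
    IsDoubling (stoppedMeasure f) := by
  -- The first summand serves the radii `r ≤ 2`; for `r ≥ 2` the double ball has mass at most `4 * B
  -- * r`, and the ball has mass at least `r`.
  refine ⟨fun h0 => ?_, 54 * (3 * K ^ 4) ^ 13 + 4 * B, ?_, fun c r hr => ?_⟩
  · have := le_stoppedMeasure_closedBall f 0 (le_refl 2)
    simp [h0] at this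
  · have : 0 < K := lt_of_lt_of_le one_pos h.one_le
    positivity
  wlog hc : 0 ≤ c generalizing c
  · have hneg : ∀ s, closedBall c s = Neg.neg ⁻¹' closedBall (-c) s := fun s => by
      ext x
      simp only [mem_preimage, mem_closedBall, Real.dist_eq]
      rw [← abs_neg]
      ring_nf
    rw [hneg, hneg, stoppedMeasure_preimage_neg f measurableSet_closedBall,
      stoppedMeasure_preimage_neg f measurableSet_closedBall]
    exact this (-c) (by linarith)
  rcases le_total r 2 with hr2 | hr2
  · refine (h.stoppedMeasure_two_mul_le hc hr hr2).trans (mul_le_mul_left ?_ _)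
    exact_mod_cast le_self_add
  · calc stoppedMeasure f (closedBall c (2 * r)) ≤ B * volume (closedBall c (2 * r)) :=
          stoppedMeasure_le measurableSet_closedBall fun x _ _ => hB x
      _ = (4 * B : ℝ≥0) * ENNReal.ofReal r := by
          rw [Real.volume_closedBall, ENNReal.ofReal_mul (by norm_num),
            ENNReal.ofReal_mul (by norm_num), ← mul_assoc, ← mul_assoc, mul_right_comm]
          push_cast
          norm_num
          ring
      _ ≤ (54 * (3 * K ^ 4) ^ 13 + 4 * B : ℝ≥0) * stoppedMeasure f (closedBall c r) :=
          mul_le_mul' (by exact_mod_cast le_add_self) (le_stoppedMeasure_closedBall f c hr2)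

end

/-! ### The maximal function of an interval -/

lemma laverage_indicator_closedBall (c r x : ℝ) (ρ : ℝ) :
    ⨍⁻ y in closedBall x ρ, ‖(closedBall c r).indicator (fun _ => (1 : ℝ)) y‖ₑ ∂volume =
      volume (closedBall c r ∩ closedBall x ρ) / volume (closedBall x ρ) := by
  rw [setLAverage_eq]
  congr 1
  simp_rw [enorm_indicator_eq_indicator_enorm, enorm_one]
  rw [lintegral_indicator_const measurableSet_closedBall, one_mul,
    Measure.restrict_apply measurableSet_closedBall]

lemma le_maximalFn_indicator (c : ℝ) {r : ℝ} (hr : 0 < r) (x : ℝ) :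
    ENNReal.ofReal (r / (r + |x - c|)) ≤
      maximalFn ((closedBall c r).indicator fun _ => 1) x := by
  have hρ : 0 < r + |x - c| := by positivity
  refine le_iSup₂_of_le (r + |x - c|) hρ ?_
  have hsub : closedBall c r ⊆ closedBall x (r + |x - c|) :=
    closedBall_subset_closedBall' (by rw [dist_comm, Real.dist_eq])
  rw [laverage_indicator_closedBall, inter_eq_left.2 hsub, Real.volume_closedBall,
    Real.volume_closedBall, ← ENNReal.ofReal_div_of_pos (by positivity),
    mul_div_mul_left _ _ two_ne_zero]

/-- For `|x - c| ≤ 2 * r` the bound is at least one. Otherwise a ball about `x` meeting the interval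
has radius at least `|x - c| - r`, which is at least `(r + |x - c|) / 3`. -/
lemma maximalFn_indicator_le (c : ℝ) {r : ℝ} (hr : 0 < r) (x : ℝ) :
    maximalFn ((closedBall c r).indicator fun _ => 1) x ≤
      ENNReal.ofReal (3 * r / (r + |x - c|)) := by
  have hρ' : 0 < r + |x - c| := by positivity
  refine iSup₂_le fun ρ hρ => ?_
  rw [laverage_indicator_closedBall]
  rcases le_total |x - c| (2 * r) with h | h
  · calc volume (closedBall c r ∩ closedBall x ρ) / volume (closedBall x ρ) ≤ 1 :=
          ENNReal.div_le_of_le_mul (by rw [one_mul]; exact measure_mono inter_subset_right)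
      _ ≤ ENNReal.ofReal (3 * r / (r + |x - c|)) := by
          rw [ENNReal.one_le_ofReal, one_le_div hρ']
          linarith
  · rcases lt_or_ge (r + ρ) |x - c| with hd | hd
    · have : Disjoint (closedBall c r) (closedBall x ρ) :=
        closedBall_disjoint_closedBall (by rwa [dist_comm, Real.dist_eq])
      simp [this.inter_eq]
    · calc volume (closedBall c r ∩ closedBall x ρ) / volume (closedBall x ρ)
          ≤ volume (closedBall c r) / volume (closedBall x ρ) := by
            gcongr; exact inter_subset_left
        _ = ENNReal.ofReal (r / ρ) := by
            rw [Real.volume_closedBall, Real.volume_closedBall,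
              ← ENNReal.ofReal_div_of_pos (by positivity), mul_div_mul_left _ _ two_ne_zero]
        _ ≤ ENNReal.ofReal (3 * r / (r + |x - c|)) := by
            refine ENNReal.ofReal_le_ofReal ?_
            rw [div_le_div_iff₀ hρ hρ']
            nlinarith

lemma rpow_mul_le_maximalIntegral {p : ℝ} (hp : 0 ≤ p) (w : ℝ → ℝ) {c r : ℝ} (hr : 0 < r)
    {t : ℝ} {A : Set ℝ} (hA : MeasurableSet A) (ht : ∀ x ∈ A, t * (r + |x - c|) ≤ r) :
    ENNReal.ofReal t ^ p * weightMeasure w A ≤ maximalIntegral p w (closedBall c r) := by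
  rw [maximalIntegral, ← setLIntegral_const]
  refine (setLIntegral_mono' hA fun x hx => ?_).trans (setLIntegral_le_lintegral A _)
  refine ENNReal.rpow_le_rpow (le_trans (ENNReal.ofReal_le_ofReal ?_)
    (le_maximalFn_indicator c hr x)) hp
  rw [le_div_iff₀ (by positivity)]
  exact ht x hx

lemma weightMeasure_closedBall_le {p : ℝ} (hp : 0 ≤ p) (w : ℝ → ℝ) {c r : ℝ} (hr : 0 < r) :
    weightMeasure w (closedBall c r) ≤
      ((2 : ℝ≥0) ^ p : ℝ≥0) * maximalIntegral p w (closedBall c r) := by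
  have h := rpow_mul_le_maximalIntegral hp w hr (t := 2⁻¹) (c := c)
    (A := closedBall c r) measurableSet_closedBall fun x hx => by
      rw [mem_closedBall, Real.dist_eq] at hx
      linarith
  refine le_trans (le_of_eq ?_) (mul_le_mul_right h _)
  rw [← mul_assoc, ENNReal.coe_rpow_of_nonneg _ hp, ← ENNReal.mul_rpow_of_nonneg _ _ hp,
    ENNReal.ofReal_inv_of_pos (by norm_num), ENNReal.ofReal_ofNat, ENNReal.coe_ofNat,
    ENNReal.mul_inv_cancel (by norm_num) (by norm_num), ENNReal.one_rpow, one_mul]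

/-- The weight is bounded and the maximal function decays like `1 / |x|`, so `p > 1` makes the
integral converge. -/
lemma maximalIntegral_lt_top {p : ℝ} (hp : 1 < p) {f : ℕ → ℝ≥0} {B : ℝ≥0}
    (hB : ∀ x, stoppedDensity f x ≤ B) (c : ℝ) {r : ℝ} (hr : 0 < r) :
    maximalIntegral p (fun x => stoppedDensity f x) (closedBall c r) < ∞ := by
  have hp0 : 0 ≤ p := by linarith
  obtain ⟨D, hD0, hD⟩ : ∃ D : ℝ, 0 < D ∧ ∀ x, 3 * r / (r + |x - c|) ≤ D * (1 + ‖x‖)⁻¹ := by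
    refine ⟨3 * r * (1 + (1 + |c|) / r), by positivity, fun x => ?_⟩
    rw [← div_eq_mul_inv, Real.norm_eq_abs, div_le_div_iff₀ (by positivity) (by positivity),
      mul_assoc (3 * r)]
    refine mul_le_mul_of_nonneg_left ?_ (by positivity)
    have h1 : |x| ≤ |x - c| + |c| := by simpa using abs_add_le (x - c) c
    have h2 : (1 + |c|) / r * r = 1 + |c| := div_mul_cancel₀ _ hr.ne'
    have h3 : 0 ≤ (1 + |c|) / r * |x - c| := by positivity
    nlinarith
  have hle : stoppedMeasure f ≤ (B : ℝ≥0∞) • volume := Measure.le_iff.2 fun s hs => by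
    simpa using stoppedMeasure_le hs fun x _ _ => hB x
  have hfin := finite_integral_one_add_norm (E := ℝ) (μ := volume) (r := p) (by simpa using hp)
  calc maximalIntegral p (fun x => stoppedDensity f x) (closedBall c r)
      ≤ ∫⁻ x, ENNReal.ofReal D ^ p * ENNReal.ofReal ((1 + ‖x‖) ^ (-p)) ∂(stoppedMeasure f) := by
        refine lintegral_mono fun x => ?_
        calc _ ≤ ENNReal.ofReal (D * (1 + ‖x‖)⁻¹) ^ p :=
              ENNReal.rpow_le_rpow ((maximalFn_indicator_le c hr x).trans
                (ENNReal.ofReal_le_ofReal (hD x))) hp0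
          _ = _ := by
              rw [ENNReal.ofReal_mul hD0.le, ENNReal.mul_rpow_of_nonneg _ _ hp0,
                ENNReal.ofReal_rpow_of_nonneg (x := (1 + ‖x‖)⁻¹) (by positivity) hp0,
                Real.inv_rpow (by positivity), Real.rpow_neg (by positivity)]
    _ ≤ ∫⁻ x, ENNReal.ofReal D ^ p * ENNReal.ofReal ((1 + ‖x‖) ^ (-p)) ∂((B : ℝ≥0∞) • volume) :=
        lintegral_mono' hle le_rfl
    _ = B * (ENNReal.ofReal D ^ p * ∫⁻ x : ℝ, ENNReal.ofReal ((1 + ‖x‖) ^ (-p))) := by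
        rw [lintegral_smul_measure, lintegral_const_mul' _ _
          (ENNReal.rpow_ne_top_of_nonneg hp0 ENNReal.ofReal_ne_top), smul_eq_mul]
    _ < ∞ := ENNReal.mul_lt_top ENNReal.coe_lt_top (ENNReal.mul_lt_top
        (ENNReal.rpow_lt_top_of_nonneg hp0 ENNReal.ofReal_ne_top) hfin)

/-! ### The `C_p` condition -/

/-- A bound of the weight on each interval by its tail-weighted mean gives the `C_p` condition with
exponent one. -/
lemma isCp_of_bound {p : ℝ} (hp : 1 < p) {f : ℕ → ℝ≥0} {B C : ℝ≥0}
    (hB : ∀ x, stoppedDensity f x ≤ B)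
    (h : ∀ c r : ℝ, 0 < r → ∃ S : ℝ≥0, (∀ x ∈ closedBall c r, x ≠ 0 → stoppedDensity f x ≤ S) ∧
      S * volume (closedBall c r) ≤
        C * maximalIntegral p (fun x => stoppedDensity f x) (closedBall c r)) :
    IsCp p fun x => stoppedDensity f x := by
  refine ⟨fun c r hr => maximalIntegral_lt_top hp hB c hr, C + 1, 1, by positivity, one_pos,
    fun c r hr E hE hEI => ?_⟩
  obtain ⟨S, hS, hSC⟩ := h c r hr
  have hv : volume (closedBall c r) ≠ 0 := by
    rw [Real.volume_closedBall]
    simpa using hr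
  have hv' : volume (closedBall c r) ≠ ∞ := measure_closedBall_lt_top.ne
  refine ENNReal.div_le_of_le_mul ?_
  rw [ENNReal.rpow_one]
  calc weightMeasure (fun x => (stoppedDensity f x : ℝ)) E ≤ S * volume E :=
        stoppedMeasure_le hE.measurableSet fun x hx => hS x (hEI hx)
    _ = S * volume (closedBall c r) * (volume E / volume (closedBall c r)) := by
        rw [mul_assoc, ENNReal.mul_div_cancel hv hv']
    _ ≤ C * maximalIntegral p (fun x => stoppedDensity f x) (closedBall c r) *
        (volume E / volume (closedBall c r)) := mul_le_mul_left hSC _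
    _ ≤ (C + 1 : ℝ≥0) * maximalIntegral p (fun x => stoppedDensity f x) (closedBall c r) *
        (volume E / volume (closedBall c r)) := by
        gcongr
        exact le_self_add
    _ = _ := by ring

section

variable {f : ℕ → ℝ≥0} {K : ℝ≥0}

lemma three_pow_level_mul_lt {x : ℝ} (h : level x ≠ 0) : 3 ^ level x * |x| < 3 := by
  obtain ⟨k, hk⟩ := Nat.exists_eq_succ_of_ne_zero h
  rcases eq_or_ne x 0 with rfl | hx
  · simp
  have h1 : ¬ level |x| ≤ k := by rw [level_abs]; omega
  rw [level_le_iff (abs_pos.2 hx), not_le] at h1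
  rw [hk, pow_succ]
  linarith

/-- At `y` the cascade is stopped at the scale `3 ^ (-2 * level y)`, which is at least `y ^ 2 / 16`:
the product `3 ^ level y * |y|` is below `3` at positive levels, and at most `4` at level zero. So
`|x|` and `|y|` lie within one cylinder length, with levels differing by at most one. -/
lemma IsBalanced.stoppedDensity_le_of_near (h : IsBalanced f K) {x y : ℝ} (hy : |y| ≤ 4)
    (hxy : 16 * |x - y| ≤ y ^ 2) : stoppedDensity f x ≤ K ^ 4 * stoppedDensity f y ∧
      stoppedDensity f y ≤ K ^ 4 * stoppedDensity f x := by
  rcases eq_or_ne y 0 with rfl | hy0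
  · have : x = 0 := by
      have := abs_nonneg (x - 0)
      have h0 : |x - 0| = 0 := by linarith
      simpa using h0
    subst this
    exact ⟨le_mul_of_one_le_left' (one_le_pow₀ h.one_le),
      le_mul_of_one_le_left' (one_le_pow₀ h.one_le)⟩
  have hyp : 0 < |y| := abs_pos.2 hy0
  rw [← sq_abs] at hxy
  have hd : |(|x| - |y|)| ≤ |x - y| := abs_abs_sub_abs_le_abs_sub x y
  have hd' := abs_le.1 hd
  have hxp : 0 < |x| := by nlinarith
  have l1 : level x ≤ level y + 1 := by
    rw [← level_abs, ← level_abs y]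
    exact level_le_level_add_one hxp hyp (by nlinarith)
  have l2 : level y ≤ level x + 1 := by
    rw [← level_abs, ← level_abs x]
    exact level_le_level_add_one hyp hxp (by nlinarith)
  have hsmall : ∀ m ≤ 2 * level y, 3 ^ m * |(|x| - |y|)| ≤ 1 := by
    intro m hm
    calc 3 ^ m * |(|x| - |y|)| ≤ 3 ^ (2 * level y) * (|y| ^ 2 / 16) := by
          gcongr
          · norm_num
          · linarith
      _ = (3 ^ level y * |y|) ^ 2 / 16 := by rw [mul_comm 2, pow_mul]; ring
      _ ≤ 4 ^ 2 / 16 := by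
          gcongr
          rcases eq_or_ne (level y) 0 with h0 | h0
          · simpa [h0] using hy
          · linarith [three_pow_level_mul_lt h0]
      _ = 1 := by norm_num
  constructor
  · exact h.cascadeDensity_le (abs_nonneg _) (abs_nonneg _) (by omega) (by omega)
      (hsmall _ (by omega))
  · refine h.cascadeDensity_le (abs_nonneg _) (abs_nonneg _) (by omega) (by omega) ?_
    rw [abs_sub_comm]
    exact hsmall _ (by omega)

lemma IsBalanced.isCp (h : IsBalanced f K) {p : ℝ} (hp : 1 < p) {k : ℕ} (hk : 2 * (p - 1) ≤ k)
    {B : ℝ≥0} (hB : ∀ x, stoppedDensity f x ≤ B)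
    (hdecay : ∀ x, x ≠ 0 → (stoppedDensity f x : ℝ) ≤ B * (min 1 |x|) ^ k) :
    IsCp p fun x => stoppedDensity f x := by
  have hp0 : 0 ≤ p := by linarith
  set C₁ : ℝ≥0 := 2 * B * 2 ^ p with hC₁
  set C₂ : ℝ≥0 := 2 ^ p with hC₂
  set C₃ : ℝ≥0 := K ^ 8 * 2 ^ p with hC₃
  set C₄ : ℝ≥0 := 2 * B * 36 ^ (p - 1) * 12 ^ p with hC₄
  have main : ∀ c r : ℝ, 0 < r → ∃ S : ℝ≥0,
      (∀ x ∈ closedBall c r, x ≠ 0 → stoppedDensity f x ≤ S) ∧ ∃ C ∈ ({C₁, C₂, C₃, C₄} : Set ℝ≥0),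
      S * volume (closedBall c r) ≤
        C * maximalIntegral p (fun x => stoppedDensity f x) (closedBall c r) := by
    intro c r hr
    have hself := weightMeasure_closedBall_le hp0 (fun x => (stoppedDensity f x : ℝ)) (c := c) hr
    change stoppedMeasure f (closedBall c r) ≤ _ at hself
    rcases le_total 2 r with hr2 | hr2
    · refine ⟨B, fun x _ _ => hB x, C₁, by simp, ?_⟩
      calc B * volume (closedBall c r) = (2 * B : ℝ≥0) * ENNReal.ofReal r := by
            rw [Real.volume_closedBall, ENNReal.ofReal_mul (by norm_num)]
            push_cast
            rw [ENNReal.ofReal_ofNat]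
            ring
        _ ≤ (2 * B : ℝ≥0) * stoppedMeasure f (closedBall c r) :=
            mul_le_mul_right (le_stoppedMeasure_closedBall f c hr2) _
        _ ≤ _ := mul_le_mul_right hself _
        _ = _ := by rw [← mul_assoc, ← ENNReal.coe_mul]
    rcases le_total 4 |c| with hc | hc
    · have hone : ∀ x ∈ closedBall c r, stoppedDensity f x = 1 := by
        intro x hx
        rw [mem_closedBall, Real.dist_eq, abs_sub_comm] at hx
        refine stoppedDensity_of_one_le f ?_
        have := abs_sub_abs_le_abs_sub c x
        linarith
      refine ⟨1, fun x hx _ => (hone x hx).le, C₂, by simp, ?_⟩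
      exact (le_stoppedMeasure measurableSet_closedBall fun x hx => (hone x hx).ge).trans hself
    rcases le_total (16 * r) (c ^ 2) with hrc | hrc
    · have hnear : ∀ x ∈ closedBall c r, 16 * |x - c| ≤ c ^ 2 := by
        intro x hx
        rw [mem_closedBall, Real.dist_eq] at hx
        linarith
      refine ⟨K ^ 4 * stoppedDensity f c,
        fun x hx _ => (h.stoppedDensity_le_of_near hc (hnear x hx)).1, C₃, by simp, ?_⟩
      have hK : 0 < K ^ 4 := pow_pos (lt_of_lt_of_le one_pos h.one_le) 4
      have hlow : ((K ^ 4)⁻¹ * stoppedDensity f c : ℝ≥0) * volume (closedBall c r) ≤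
          stoppedMeasure f (closedBall c r) := by
        refine le_stoppedMeasure measurableSet_closedBall fun x hx => ?_
        rw [inv_mul_le_iff₀ hK]
        exact (h.stoppedDensity_le_of_near hc (hnear x hx)).2
      calc ((K ^ 4 * stoppedDensity f c : ℝ≥0) : ℝ≥0∞) * volume (closedBall c r)
          = (K ^ 8 : ℝ≥0) *
            (((K ^ 4)⁻¹ * stoppedDensity f c : ℝ≥0) * volume (closedBall c r)) := by
            rw [← mul_assoc, ← ENNReal.coe_mul]
            congr 2
            rw [← mul_assoc, show K ^ 8 = K ^ 4 * K ^ 4 by ring, mul_inv_cancel_right₀ hK.ne']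
        _ ≤ (K ^ 8 : ℝ≥0) * _ := mul_le_mul_right (hlow.trans hself) _
        _ = _ := by rw [← mul_assoc, ← ENNReal.coe_mul]
    -- Here the oscillation is visible and only the decay of the weight helps. From `c ^ 2 ≤ 16 * r`
    -- and `r ≤ 2` follows `(|c| + r) ^ 2 ≤ 2 * c ^ 2 + 2 * r ^ 2 ≤ 36 * r`.
    · obtain ⟨S, hS⟩ : ∃ S : ℝ≥0, (S : ℝ) = B * (36 * r) ^ (p - 1) :=
        ⟨Real.toNNReal _, Real.coe_toNNReal _ (by positivity)⟩
      refine ⟨S, fun x hx hx0 => ?_, C₄, by simp, ?_⟩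
      · rw [← NNReal.coe_le_coe, hS]
        refine (hdecay x hx0).trans (mul_le_mul_of_nonneg_left ?_ B.2)
        rw [mem_closedBall, Real.dist_eq] at hx
        have hx' : |x| ≤ |c| + r := by
          have := abs_sub_abs_le_abs_sub x c
          linarith
        have hm : 0 < min 1 |x| := lt_min one_pos (abs_pos.2 hx0)
        calc (min 1 |x|) ^ k = (min 1 |x|) ^ (k : ℝ) := (Real.rpow_natCast _ _).symm
          _ ≤ (min 1 |x|) ^ (2 * (p - 1)) :=
              Real.rpow_le_rpow_of_exponent_ge hm (min_le_left _ _) hk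
          _ = ((min 1 |x|) ^ 2) ^ (p - 1) := by
              rw [Real.rpow_mul hm.le, Real.rpow_two]
          _ ≤ (36 * r) ^ (p - 1) := by
              refine Real.rpow_le_rpow (by positivity) ?_ (by linarith)
              calc (min 1 |x|) ^ 2 ≤ (|c| + r) ^ 2 := by
                    gcongr
                    exact (min_le_right _ _).trans hx'
                _ ≤ 36 * r := by nlinarith [sq_abs c, sq_nonneg (|c| - r)]
      · have h56 : (1 : ℝ≥0∞) ≤ stoppedMeasure f (Icc 5 6) := by
          have := le_stoppedMeasure (f := f) (B := 1) (s := Icc 5 6) measurableSet_Icc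
            fun x hx => by
              rw [stoppedDensity_of_one_le]
              exact le_trans (by linarith [hx.1]) (le_abs_self x)
          refine le_trans (le_of_eq ?_) this
          rw [Real.volume_Icc]
          norm_num
        -- On `[5, 6]` one has `r + |x - c| ≤ 2 + 10`, so the maximal function is at least `r / 12`
        -- there.
        have hfar := rpow_mul_le_maximalIntegral hp0 (fun x => (stoppedDensity f x : ℝ)) hr
          (c := c) (t := r / 12) (A := Icc 5 6) measurableSet_Icc fun x hx => by
            have h1 : |x - c| ≤ 10 := by
              have := abs_le.1 hc
              rw [abs_le]
              constructor <;> linarith [hx.1, hx.2]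
            nlinarith
        have hfar' := (mul_le_mul_right h56 (ENNReal.ofReal (r / 12) ^ p)).trans hfar
        rw [mul_one] at hfar'
        refine le_trans (le_of_eq ?_) (mul_le_mul_right hfar' _)
        rw [ENNReal.ofReal_rpow_of_nonneg (by positivity) hp0, Real.volume_closedBall,
          ← ENNReal.ofReal_coe_nnreal, ← ENNReal.ofReal_coe_nnreal,
          ← ENNReal.ofReal_mul (by positivity), ← ENNReal.ofReal_mul (by positivity)]
        congr 1
        simp only [hC₄, hS, NNReal.coe_mul, NNReal.coe_rpow, NNReal.coe_ofNat]
        rw [Real.mul_rpow (by norm_num) hr.le, Real.div_rpow hr.le (by norm_num)]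
        have e1 : r ^ p = r ^ (p - 1) * r := by
          rw [← Real.rpow_add_one hr.ne', sub_add_cancel]
        have e2 : (12 : ℝ) ^ p ≠ 0 := by positivity
        rw [e1]
        field_simp
  refine isCp_of_bound hp hB (C := C₁ + C₂ + C₃ + C₄) fun c r hr => ?_
  obtain ⟨S, hS, C, hC, hSC⟩ := main c r hr
  refine ⟨S, hS, hSC.trans (mul_le_mul_left ?_ _)⟩
  rw [ENNReal.coe_le_coe]
  simp only [mem_insert_iff, mem_singleton_iff] at hC
  rcases hC with rfl | rfl | rfl | rfl
  · exact le_add_right (le_add_right le_self_add)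
  · exact le_add_right (le_add_right le_add_self)
  · exact le_add_right le_add_self
  · exact le_add_self

end

/-! ### Failure of both forms of `A_∞` -/

section

variable {f : ℕ → ℝ≥0} {K : ℝ≥0}

lemma stoppedDensity_eq_of_mem_triadic (f : ℕ → ℝ≥0) {j : ℕ} {x : ℝ} (hx : x ∈ triadic j 1) :
    stoppedDensity f x = cascadeDensity f (j + j) x := by
  rw [stoppedDensity, level_eq_of_mem_triadic le_rfl hx, level_div_pow le_rfl (by norm_num),
    abs_of_nonneg (mem_triadic.1 hx).1, two_mul]

lemma triadic_one_ae_eq (j : ℕ) :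
    (triadic j 1 : Set ℝ) =ᵐ[volume] closedBall (3 / 2 * (3 ^ j)⁻¹) (1 / 2 * (3 ^ j)⁻¹) := by
  rw [Real.closedBall_eq_Icc, triadic]
  rw [show (3 / 2 * (3 ^ j)⁻¹ - 1 / 2 * (3 ^ j)⁻¹ : ℝ) = (1 : ℕ) / 3 ^ j by push_cast; ring,
    show (3 / 2 * (3 ^ j)⁻¹ + 1 / 2 * (3 ^ j)⁻¹ : ℝ) = ((1 : ℕ) + 1) / 3 ^ j by push_cast; ring]
  exact Ico_ae_eq_Icc

lemma triadic_one_subset (j : ℕ) :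
    triadic j 1 ⊆ closedBall (3 / 2 * (3 ^ j)⁻¹ : ℝ) (1 / 2 * (3 ^ j)⁻¹) := by
  rw [Real.closedBall_eq_Icc, triadic]
  convert Ico_subset_Icc_self using 2 <;> (push_cast; ring)

lemma setLAverage_triadic (g : ℝ → ℝ≥0∞) (j : ℕ) :
    ⨍⁻ x in closedBall (3 / 2 * (3 ^ j)⁻¹ : ℝ) (1 / 2 * (3 ^ j)⁻¹), g x ∂volume =
      (∫⁻ x in triadic j 1, g x) * 3 ^ j := by
  rw [setLAverage_eq, ← setLIntegral_congr (triadic_one_ae_eq j),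
    ← measure_congr (triadic_one_ae_eq j), volume_triadic, div_eq_mul_inv, inv_inv]

lemma setLAverage_cascadeDensity (f : ℕ → ℝ≥0) (j : ℕ) :
    ⨍⁻ x in closedBall (3 / 2 * (3 ^ j)⁻¹ : ℝ) (1 / 2 * (3 ^ j)⁻¹),
      (cascadeDensity f (j + j) x : ℝ≥0∞) ∂volume =
      (((f 0 + f 1 + f 2) / 3) ^ j * cascade f j 1 : ℝ≥0) := by
  rw [setLAverage_triadic, lintegral_cascadeDensity, mul_assoc, ENNReal.inv_mul_cancel (by simp)
    (by simp), mul_one]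
  push_cast
  rfl

lemma add_mul_sub_le_rpow {x e : ℝ} (hx : 0 < x) (he : e < 0) : 1 + e * (x - 1) ≤ x ^ e := by
  rw [Real.rpow_def_of_pos hx]
  have h1 := Real.add_one_le_exp (Real.log x * e)
  have h2 := Real.log_le_sub_one_of_pos hx
  nlinarith

lemma add_mul_sub_lt_rpow {x e : ℝ} (hx : 0 < x) (hx1 : x ≠ 1) (he : e < 0) :
    1 + e * (x - 1) < x ^ e := by
  rw [Real.rpow_def_of_pos hx]
  have h1 := Real.add_one_le_exp (Real.log x * e)
  have h2 := Real.log_lt_sub_one_of_pos hx hx1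
  nlinarith

/-- Strict Jensen inequality: in the sum of the tangent-line bounds at `1` the linear terms cancel,
the mean being one. -/
lemma IsBalanced.one_lt_mean_rpow (h : IsBalanced f K) (h0 : f 0 ≠ 1) {e : ℝ} (he : e < 0) :
    1 < (f 0 ^ e + f 1 ^ e + f 2 ^ e) / 3 := by
  rw [lt_div_iff₀ (by norm_num), one_mul, ← NNReal.coe_lt_coe]
  push_cast
  have hs : (f 0 + f 1 + f 2 : ℝ) = 3 := by exact_mod_cast h.sum
  have h0' : (f 0 : ℝ) ≠ 1 := by exact_mod_cast h0
  have hp : ∀ {d}, d < 3 → (0 : ℝ) < f d := fun hd => by exact_mod_cast h.pos hd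
  have e0 := add_mul_sub_lt_rpow (hp (d := 0) (by norm_num)) h0' he
  have e1 := add_mul_sub_le_rpow (hp (d := 1) (by norm_num)) he
  have e2 := add_mul_sub_le_rpow (hp (d := 2) (by norm_num)) he
  have : e * ((f 0 : ℝ) - 1) + e * ((f 1 : ℝ) - 1) + e * ((f 2 : ℝ) - 1) = 0 := by
    rw [← mul_add, ← mul_add]
    convert mul_zero e using 2
    linarith
  linarith

lemma IsBalanced.mean_sqrt_lt_one (h : IsBalanced f K) (h0 : f 0 ≠ 1) :
    (NNReal.sqrt (f 0) + NNReal.sqrt (f 1) + NNReal.sqrt (f 2)) / 3 < 1 := by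
  rw [div_lt_one (by norm_num), ← h.sum, ← NNReal.coe_lt_coe]
  have hs : (f 0 + f 1 + f 2 : ℝ) = 3 := by exact_mod_cast h.sum
  have hsq : ∀ d, ((NNReal.sqrt (f d) : ℝ≥0) : ℝ) ^ 2 = f d := fun d => by
    exact_mod_cast NNReal.sq_sqrt (f d)
  have h1 : ((NNReal.sqrt (f 0) : ℝ≥0) : ℝ) - 1 ≠ 0 := by
    rw [sub_ne_zero]
    exact_mod_cast fun hc => h0 (by rwa [NNReal.sqrt_eq_one] at hc)
  have h2 := pow_pos (abs_pos.2 h1) 2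
  rw [sq_abs] at h2
  simp only [NNReal.coe_add]
  have e0 := hsq 0
  have e1 := hsq 1
  have e2 := hsq 2
  nlinarith [sq_nonneg (((NNReal.sqrt (f 1) : ℝ≥0) : ℝ) - 1),
    sq_nonneg (((NNReal.sqrt (f 2) : ℝ≥0) : ℝ) - 1)]

/-- On `triadic j 1` the level is `j`, so `j` generations remain after generation `j`. The common
factor `cascade f j 1` cancels from the `A_q` product and leaves `σ ^ (j * (q - 1))` with `σ > 1`,
which is unbounded. -/
lemma IsBalanced.not_isAInfty (h : IsBalanced f K) (h0 : f 0 ≠ 1) :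
    ¬ IsAInfty fun x => stoppedDensity f x := by
  rintro ⟨q, hq, C, hC⟩
  set e := 1 / (1 - q) with he
  have he0 : e < 0 := one_div_neg.2 (by linarith)
  have heq : e * (q - 1) = -1 := by
    rw [he, one_div, ← neg_sub q 1, inv_neg, neg_mul, inv_mul_cancel₀ (by linarith)]
  set σ := (f 0 ^ e + f 1 ^ e + f 2 ^ e) / 3 with hσ
  have hσ1 : 1 < σ ^ (q - 1) :=
    NNReal.one_lt_rpow (h.one_lt_mean_rpow h0 he0) (by linarith)
  obtain ⟨j, hj⟩ := pow_unbounded_of_one_lt C hσ1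
  refine not_le.2 hj ?_
  have hmap := cascade_map (g := fun y : ℝ≥0 => y ^ e) (NNReal.one_rpow e)
    (fun x y => NNReal.mul_rpow) f
  have key := hC (3 / 2 * (3 ^ j)⁻¹) (1 / 2 * (3 ^ j)⁻¹) (by positivity)
  have e1 : ⨍⁻ x in closedBall (3 / 2 * (3 ^ j)⁻¹ : ℝ) (1 / 2 * (3 ^ j)⁻¹),
      ENNReal.ofReal (stoppedDensity f x : ℝ) ∂volume = cascade f j 1 := by
    rw [setLAverage_triadic, setLIntegral_congr_fun (measurableSet_triadic j 1)
      (g := fun x => (cascadeDensity f (j + j) x : ℝ≥0∞)), ← setLAverage_triadic,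
      setLAverage_cascadeDensity, h.mean, one_pow, one_mul]
    intro x hx
    simp only [ENNReal.ofReal_coe_nnreal, stoppedDensity_eq_of_mem_triadic f hx]
  have e2 : ⨍⁻ x in closedBall (3 / 2 * (3 ^ j)⁻¹ : ℝ) (1 / 2 * (3 ^ j)⁻¹),
      ENNReal.ofReal (stoppedDensity f x : ℝ) ^ e ∂volume =
      (σ ^ j * cascade f j 1 ^ e : ℝ≥0) := by
    rw [setLAverage_triadic, setLIntegral_congr_fun (measurableSet_triadic j 1)
      (g := fun x => (cascadeDensity (fun d => f d ^ e) (j + j) x : ℝ≥0∞)), ← setLAverage_triadic,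
      setLAverage_cascadeDensity, hmap]
    intro x hx
    simp only [ENNReal.ofReal_coe_nnreal, stoppedDensity_eq_of_mem_triadic f hx]
    rw [cascadeDensity, cascadeDensity, hmap, ENNReal.coe_rpow_of_ne_zero (h.cascade_pos _ _).ne']
  have hP := h.cascade_pos j 1
  rw [e1, e2, ← ENNReal.coe_rpow_of_nonneg _ (by linarith), ← ENNReal.coe_mul,
    ENNReal.coe_le_coe] at key
  convert key using 1
  rw [NNReal.mul_rpow, ← NNReal.rpow_mul, heq, NNReal.rpow_neg_one, mul_left_comm,
    mul_inv_cancel₀ hP.ne', mul_one, ← NNReal.rpow_natCast, ← NNReal.rpow_natCast,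
    ← NNReal.rpow_mul, ← NNReal.rpow_mul, mul_comm]

/-- Chebyshev's inequality for the square root of the density, whose normalised mean is the `j`-th
power of the mean of the square roots of the factors. Where the density exceeds its mean the root
controls Lebesgue measure; elsewhere the density is at most its root times the root of the mean. The
factor `cascade f j 1` stays on both sides as it may vanish for general `f`. -/
lemma exists_concentration (f : ℕ → ℝ≥0) (j : ℕ) :
    ∃ E ⊆ triadic j 1, MeasurableSet E ∧
      cascade f j 1 * volume E ≤ cascade f j 1 *
        (((NNReal.sqrt (f 0) + NNReal.sqrt (f 1) + NNReal.sqrt (f 2)) / 3 : ℝ≥0) ^ j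
          * (3 ^ j)⁻¹) ∧
      ∫⁻ x in triadic j 1 \ E, cascadeDensity f (j + j) x ≤ cascade f j 1 *
        (((NNReal.sqrt (f 0) + NNReal.sqrt (f 1) + NNReal.sqrt (f 2)) / 3 : ℝ≥0) ^ j
          * (3 ^ j)⁻¹) := by
  have hmap := cascade_map (g := NNReal.sqrt) NNReal.sqrt_one NNReal.sqrt_mul f
  set g : ℕ → ℝ≥0 := fun d => NNReal.sqrt (f d) with hg
  set θ : ℝ≥0 := (NNReal.sqrt (f 0) + NNReal.sqrt (f 1) + NNReal.sqrt (f 2)) / 3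
  have hsq : ∀ n i, cascade f n i = cascade g n i * cascade g n i := fun n i => by
    rw [hmap, NNReal.mul_self_sqrt]
  have hint : ∫⁻ x in triadic j 1, cascadeDensity g (j + j) x =
      θ ^ j * cascade g j 1 * (3 ^ j)⁻¹ := lintegral_cascadeDensity g j j 1
  have hgm := measurable_cascadeDensity g (j + j)
  refine ⟨triadic j 1 ∩ {x | cascade g j 1 ≤ cascadeDensity g (j + j) x}, inter_subset_left,
    (measurableSet_triadic j 1).inter (measurableSet_le measurable_const hgm), ?_, ?_⟩
  · rw [hsq, ENNReal.coe_mul, mul_assoc, mul_assoc]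
    refine mul_le_mul_right ?_ _
    calc (cascade g j 1 : ℝ≥0∞) *
          volume (triadic j 1 ∩ {x | cascade g j 1 ≤ cascadeDensity g (j + j) x})
        ≤ ∫⁻ x in triadic j 1 ∩ {x | cascade g j 1 ≤ cascadeDensity g (j + j) x},
          cascadeDensity g (j + j) x := by
          rw [← setLIntegral_const]
          refine setLIntegral_mono' ((measurableSet_triadic j 1).inter
            (measurableSet_le measurable_const hgm)) fun x hx => ?_
          exact_mod_cast hx.2
      _ ≤ ∫⁻ x in triadic j 1, cascadeDensity g (j + j) x := lintegral_mono_set inter_subset_left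
      _ = _ := by rw [hint]; ring
  · calc ∫⁻ x in triadic j 1 \ (triadic j 1 ∩ {x | cascade g j 1 ≤ cascadeDensity g (j + j) x}),
          (cascadeDensity f (j + j) x : ℝ≥0∞)
        ≤ ∫⁻ x in triadic j 1 \ (triadic j 1 ∩ {x | cascade g j 1 ≤ cascadeDensity g (j + j) x}),
          cascade g j 1 * (cascadeDensity g (j + j) x : ℝ≥0∞) := by
          refine setLIntegral_mono' ((measurableSet_triadic j 1).diff
            ((measurableSet_triadic j 1).inter (measurableSet_le measurable_const hgm)))
            fun x hx => ?_
          rw [← ENNReal.coe_mul, ENNReal.coe_le_coe]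
          have hlt : cascadeDensity g (j + j) x < cascade g j 1 := by
            by_contra hc
            exact hx.2 ⟨hx.1, not_lt.1 hc⟩
          change cascade f _ _ ≤ _
          rw [hsq]
          exact mul_le_mul_left hlt.le _
      _ ≤ ∫⁻ x in triadic j 1, cascade g j 1 * (cascadeDensity g (j + j) x : ℝ≥0∞) :=
          lintegral_mono_set sdiff_subset
      _ = _ := by
          rw [lintegral_const_mul _ hgm.coe_nnreal_ennreal, hint, hsq, ENNReal.coe_mul]
          ring

lemma IsBalanced.not_isAInftyPower (h : IsBalanced f K) (h0 : f 0 ≠ 1) :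
    ¬ IsAInftyPower fun x => stoppedDensity f x := by
  rintro ⟨C, ε, -, hε, hC⟩
  set θ : ℝ≥0 := (NNReal.sqrt (f 0) + NNReal.sqrt (f 1) + NNReal.sqrt (f 2)) / 3 with hθ
  have hθ1 : θ < 1 := h.mean_sqrt_lt_one h0
  -- Splitting the mass of the interval between `E` and its complement bounds one by a quantity that
  -- tends to zero.
  have key : ∀ j : ℕ, 1 ≤ C * (θ ^ j) ^ ε + θ ^ j := by
    intro j
    obtain ⟨E, hET, hE, hE1, hE2⟩ := exists_concentration f j
    rw [← hθ] at hE1 hE2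
    have hP := h.cascade_pos j 1
    have hP' : (cascade f j 1 : ℝ≥0∞) ≠ 0 := by exact_mod_cast hP.ne'
    have hT : stoppedMeasure f (triadic j 1) = cascade f j 1 * (3 ^ j)⁻¹ := by
      rw [stoppedMeasure_apply]
      exact h.triadicMass_of_lt j le_rfl (by norm_num)
    have hI : weightMeasure (fun x => (stoppedDensity f x : ℝ))
        (closedBall (3 / 2 * (3 ^ j)⁻¹ : ℝ) (1 / 2 * (3 ^ j)⁻¹)) = cascade f j 1 * (3 ^ j)⁻¹ := by
      rw [← hT]
      exact (measure_congr ((withDensity_absolutelyContinuous volume _).ae_eq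
        (triadic_one_ae_eq j))).symm
    have hvE : volume E / volume (closedBall (3 / 2 * (3 ^ j)⁻¹ : ℝ) (1 / 2 * (3 ^ j)⁻¹)) ≤
        (θ ^ j : ℝ≥0) := by
      rw [← measure_congr (triadic_one_ae_eq j), volume_triadic]
      refine ENNReal.div_le_of_le_mul ?_
      rw [ENNReal.coe_pow]
      exact (ENNReal.mul_le_mul_iff_right hP' ENNReal.coe_ne_top).1 hE1
    have hm0 : (cascade f j 1 : ℝ≥0∞) * (3 ^ j)⁻¹ ≠ 0 :=
      mul_ne_zero hP' (ENNReal.inv_ne_zero.2 (by simp))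
    have hm1 : (cascade f j 1 : ℝ≥0∞) * (3 ^ j)⁻¹ ≠ ∞ :=
      ENNReal.mul_ne_top ENNReal.coe_ne_top (ENNReal.inv_ne_top.2 (by simp))
    have hle := hC (3 / 2 * (3 ^ j)⁻¹) (1 / 2 * (3 ^ j)⁻¹) (by positivity) E hE
      (hET.trans (triadic_one_subset j))
    rw [hI, ENNReal.div_le_iff hm0 hm1] at hle
    have hle' := hle.trans (mul_le_mul_left (mul_le_mul_right
      (ENNReal.rpow_le_rpow hvE hε.le) _) _)
    have hdiff : stoppedMeasure f (triadic j 1 \ E) ≤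
        (θ ^ j : ℝ≥0) * (cascade f j 1 * (3 ^ j)⁻¹) := by
      rw [stoppedMeasure_apply, setLIntegral_congr_fun ((measurableSet_triadic j 1).diff hE)
        (g := fun x => (cascadeDensity f (j + j) x : ℝ≥0∞))
        fun x hx => by simp only [stoppedDensity_eq_of_mem_triadic f hx.1]]
      refine hE2.trans (le_of_eq ?_)
      rw [ENNReal.coe_pow]
      ring
    have hsum : 1 * (cascade f j 1 * (3 ^ j)⁻¹ : ℝ≥0∞) ≤
        (C * (θ ^ j : ℝ≥0) ^ ε + (θ ^ j : ℝ≥0)) * (cascade f j 1 * (3 ^ j)⁻¹) := by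
      rw [one_mul, add_mul, ← hT, ← union_sdiff_cancel hET]
      refine (measure_union_le _ _).trans (add_le_add ?_ ?_)
      · rw [union_sdiff_cancel hET, hT]
        exact hle'
      · rw [union_sdiff_cancel hET, hT]
        exact hdiff
    rw [ENNReal.mul_le_mul_iff_left hm0 hm1, ← ENNReal.coe_rpow_of_nonneg _ hε.le] at hsum
    exact_mod_cast hsum
  have hpow : Filter.Tendsto (fun j : ℕ => θ ^ j) Filter.atTop (nhds 0) :=
    tendsto_pow_atTop_nhds_zero_of_lt_one zero_le hθ1
  have hlim : Filter.Tendsto (fun j : ℕ => C * (θ ^ j) ^ ε + θ ^ j) Filter.atTop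
      (nhds (C * 0 ^ ε + 0)) :=
    ((((NNReal.continuous_rpow_const hε.le).tendsto 0).comp hpow).const_mul C).add hpow
  have := ge_of_tendsto' hlim key
  rw [NNReal.zero_rpow hε.ne', mul_zero, add_zero] at this
  exact absurd this (by norm_num)

lemma IsBalanced.isWeight (h : IsBalanced f K) {B : ℝ≥0} (hB : ∀ x, stoppedDensity f x ≤ B) :
    IsWeight fun x => stoppedDensity f x := by
  refine ⟨?_, Filter.Eventually.of_forall fun x => ?_⟩
  · refine (locallyIntegrable_const (B : ℝ)).mono
      (measurable_stoppedDensity f).coe_nnreal_real.aestronglyMeasurable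
      (Filter.Eventually.of_forall fun x => ?_)
    simpa using hB x
  · exact_mod_cast h.cascade_pos _ _

/-! ### Choice of the digit factors -/

/-- Digit factors with mean one and the value `3⁻ᵏ⁻¹` at the extreme digits. -/
noncomputable def digitFactor (k d : ℕ) : ℝ≥0 :=
  if d = 1 then 3 - 2 * 3⁻¹ ^ (k + 1) else 3⁻¹ ^ (k + 1)

lemma inv_three_pow_le (k : ℕ) : (3⁻¹ : ℝ≥0) ^ (k + 1) ≤ 3⁻¹ := by
  rw [pow_succ]
  exact mul_le_of_le_one_left' (pow_le_one₀ (by positivity) (inv_le_one_of_one_le₀ (by norm_num)))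

lemma digitFactor_zero_ne_one (k : ℕ) : digitFactor k 0 ≠ 1 := by
  have h : digitFactor k 0 ≤ 3⁻¹ := by simpa [digitFactor] using inv_three_pow_le k
  exact (h.trans_lt (inv_lt_one_of_one_lt₀ (by norm_num))).ne

lemma isBalanced_digitFactor (k : ℕ) : IsBalanced (digitFactor k) (3 ^ (k + 2)) := by
  have h1 := inv_three_pow_le k
  have h2 : 2 * (3⁻¹ : ℝ≥0) ^ (k + 1) ≤ 2 :=
    mul_le_of_le_one_right' (h1.trans (inv_le_one_of_one_le₀ (by norm_num)))
  have h3 : (1 : ℝ≥0) ≤ 3 ^ (k + 2) := one_le_pow₀ (by norm_num)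
  refine ⟨?_, by simp [digitFactor], fun d _ => ?_, ?_⟩
  · rw [pow_succ]
    exact le_mul_of_one_le_left' (one_le_pow₀ (by norm_num))
  · rw [digitFactor]
    split_ifs
    · refine one_le_mul_of_one_le_of_one_le h3 (le_tsub_of_add_le_left ?_)
      calc 2 * (3⁻¹ : ℝ≥0) ^ (k + 1) + 1 ≤ 2 + 1 := by gcongr
        _ = 3 := by norm_num
    · rw [pow_succ, mul_right_comm, ← mul_pow, mul_inv_cancel₀ (by norm_num), one_pow, one_mul]
      norm_num
  · have e0 : digitFactor k 0 = 3⁻¹ ^ (k + 1) := if_neg (by norm_num)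
    have e1 : digitFactor k 1 = 3 - 2 * 3⁻¹ ^ (k + 1) := if_pos rfl
    have e2 : digitFactor k 2 = 3⁻¹ ^ (k + 1) := if_neg (by norm_num)
    rw [e0, e1, e2, add_right_comm, ← two_mul]
    exact add_tsub_cancel_of_le (h2.trans (show (2 : ℝ≥0) ≤ 3 by norm_num))

/-- At level `j + 1` the first `j` digits vanish and contribute `3 ^ (-(k + 1) * j)`. The remaining
`j + 2` generations gain at most a factor `3` each; the extra one in the exponent `k + 1` absorbs
this growth and leaves the power `k`. -/
lemma stoppedDensity_digitFactor_le (k : ℕ) {x : ℝ} (hx : x ≠ 0) :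
    (stoppedDensity (digitFactor k) x : ℝ) ≤ (3 ^ (k + 2) : ℝ≥0) * (min 1 |x|) ^ k := by
  rcases le_or_gt 1 |x| with h1 | h1
  · rw [stoppedDensity_of_one_le _ h1, min_eq_left h1, one_pow, mul_one, NNReal.coe_le_coe]
    exact one_le_pow₀ (by norm_num)
  have hxp := abs_pos.2 hx
  obtain ⟨j, hj⟩ : ∃ j, level x = j + 1 := by
    refine Nat.exists_eq_succ_of_ne_zero fun h0 => ?_
    have := (level_le_iff hxp).1 (level_abs x).le
    rw [h0, pow_zero, one_mul] at this
    linarith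
  have hlow : cascadeDensity (digitFactor k) j |x| = (3⁻¹ ^ (k + 1)) ^ j := by
    have : ⌊3 ^ j * |x|⌋₊ = 0 := by
      rw [Nat.floor_eq_zero, ← not_le, ← level_le_iff hxp, level_abs]
      omega
    rw [cascadeDensity, this, cascade_zero_right]
    simp [digitFactor]
  have hup := (isBalanced_digitFactor k).cascadeDensity_add_le j (j + 2) |x|
  rw [hlow] at hup
  have hge : (3⁻¹ : ℝ) ^ (j + 1) ≤ |x| := by
    have := (level_le_iff hxp).1 ((level_abs x).trans hj).le
    rw [inv_pow, inv_le_iff_one_le_mul₀ (by positivity), mul_comm]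
    exact this
  rw [stoppedDensity, hj, show 2 * (j + 1) = j + (j + 2) by ring, min_eq_right h1.le]
  calc (cascadeDensity (digitFactor k) (j + (j + 2)) |x| : ℝ)
      ≤ (3 ^ (j + 2) * (3⁻¹ ^ (k + 1)) ^ j : ℝ≥0) := by exact_mod_cast hup
    _ = (3 ^ (k + 2) : ℝ≥0) * ((3⁻¹ : ℝ) ^ (j + 1)) ^ k := by
        push_cast
        simp only [inv_pow, ← pow_mul]
        field_simp
        ring
    _ ≤ (3 ^ (k + 2) : ℝ≥0) * |x| ^ k := by gcongr

lemma stoppedDensity_digitFactor_le_const (k : ℕ) (x : ℝ) :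
    stoppedDensity (digitFactor k) x ≤ 3 ^ (k + 2) := by
  rcases eq_or_ne x 0 with rfl | hx
  · have : stoppedDensity (digitFactor k) 0 = 1 := by
      simp [stoppedDensity, level, cascadeDensity, cascade]
    rw [this]
    exact one_le_pow₀ (by norm_num)
  · rw [← NNReal.coe_le_coe]
    exact (stoppedDensity_digitFactor_le k hx).trans
      (mul_le_of_le_one_right (by positivity) (pow_le_one₀ (by positivity) (min_le_left _ _)))

end

theorem mainTheorem4 (p : ℝ) (hp : 1 < p) :
    ∃ w : ℝ → ℝ, IsWeight w ∧ IsDoubling (weightMeasure w) ∧ IsCp p w ∧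
      ¬ IsAInfty w ∧ ¬ IsAInftyPower w := by
  obtain ⟨k, hk⟩ := exists_nat_ge (2 * (p - 1))
  have h := isBalanced_digitFactor k
  have hB := stoppedDensity_digitFactor_le_const k
  exact ⟨fun x => stoppedDensity (digitFactor k) x, h.isWeight hB, h.isDoubling hB,
    h.isCp hp hk hB fun x hx => stoppedDensity_digitFactor_le k hx,
    h.not_isAInfty (digitFactor_zero_ne_one k), h.not_isAInftyPower (digitFactor_zero_ne_one k)⟩
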